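/- **Setting.** There are $m$ infinite rays with common origin $O$. An instance $I$ of weighted search consists of a weight objective $W\ge 0$ and, for each ray $i\in\{0,\dots,m-1\}$, a distance $d_i\in[1,\infty]$ and a weight $w_i\ge 0$: a target of weight $w_i$ lies on ray $i$ at distance $d_i$ from $O$, and $d_i=\infty$ means that there is no target on ray $i$. The targets present suffice: $\sum_{i:\,d_i<\infty} w_i\ge W$. For a set $S$ of (rays containing) targets put $d_S=2\sum_{i\in S}d_i-\max_{i\in S}d_i$ (with $d_\emptyset=0$) and $w_S=\sum_{i\in S}w_i$. Let $\mathrm{opt}(I)=\min\{d_S: w_S\ge W\}$ and $s_I=\max\{|S| : w_S\ge W,\ d_S=\mathrm{opt}(I)\}$. A (deterministic) strategy $\Sigma$ chooses, whenever the searcher is at $O$, a ray $r$ and a depth $l\in[0,\infty]$, depending on $W$ and on everything observed so far. The searcher traverses $r$ until it meets the target of $r$ or reaches depth $l$, and returns to $O$; a target met is found, its distance and weight are revealed, and its ray is never traversed again. The cost $c(\Sigma,I)$ is the total distance traversed until the first time at which the targets found have aggregate weight at least $W$ (and $\infty$ if this never happens). The strategy $\mathrm{AdSch}$ works as follows. Put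 $b_{m,f}=1+\frac1{m-f}$, with $b_{m,m}=\infty$. Initially $f=1$, $r=0$, $D=1$ and the rays are labelled $0,\dots,m-1$. Repeatedly, explore the ray labelled $r$ to depth $D\cdot b_{m,f}$. If no target is found, replace $r$ by $r+1 \bmod (m-f+1)$ and $D$ by $D\cdot b_{m,f}$. If a target is found, increase $f$ by $1$, remove the ray, relabel the remaining rays in order as $0,\dots,m-f$, and replace $r$ by $r \bmod (m-f+1)$. Stop as soon as the targets found have aggregate weight at least $W$. Let $\phi(x)=1+2(1+x)\left(1+\frac1x\right)^x$ for $x>0$. **Theorem.** 1. For every $m$ and every instance $I$ on $m$ rays, $c(\mathrm{AdSch},I)\le\phi(m-s_I)\cdot\mathrm{opt}(I)$ if $s_I<m$, and $c(\mathrm{AdSch},I)\le(3+2e)\cdot\mathrm{opt}(I)$ if $s_I=m$. 2. For every $m$, every strategy $\Sigma$ on $m$ rays, every $s\in\{1,\dots,m-1\}$ and every $\varepsilon>0$ there is an instance $I$ on $m$ rays with $s_I=s$ and $c(\Sigma,I)\ge(\phi(m-s)-\varepsilon)\cdot\mathrm{opt}(I)$. 3. For every $m\ge 2$, every strategy $\Sigma$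 on $m$ rays and every $\varepsilon>0$ there is an instance $I$ on $m$ rays with $s_I=m$ and $c(\Sigma,I)\ge(2-\varepsilon)\cdot\mathrm{opt}(I)$. -/

import Mathlib

open scoped NNReal ENNReal

noncomputable section

/-- The function `φ(x) = 1 + 2 (1 + x) (1 + 1/x)^x`, used for `x > 0`. -/
def phi (x : ℝ) : ℝ := 1 + 2 * (1 + x) * (1 + 1 / x) ^ x

/-- An instance of weighted search on `m` rays. The target on ray `i` has weight `w i` and lies at
distance `d i ≥ 1` from the origin; `d i = ⊤` means that no target is hidden on ray `i`. The
targets that are present suffice to reach the weight objective `W`. -/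
structure WSInstance (m : ℕ) where
  W : ℝ≥0
  d : Fin m → ℝ≥0∞
  w : Fin m → ℝ≥0
  one_le_d : ∀ i, 1 ≤ d i
  feasible : W ≤ ∑ i with d i ≠ ⊤, w i

namespace WSInstance

variable {m : ℕ} (I : WSInstance m)

/-- The rays on which a target is hidden. -/
def targets : Finset (Fin m) := {i | I.d i ≠ ⊤}

/-- The aggregate weight of a set of targets. -/
def weight (S : Finset (Fin m)) : ℝ≥0 := ∑ i ∈ S, I.w i

/-- `d_S = 2 ∑_{i ∈ S} d_i - max_{i ∈ S} d_i` (and `0` for `S = ∅`). It is only used for sets of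
targets, all of which have finite distances. -/
def setCost (S : Finset (Fin m)) : ℝ≥0∞ := 2 * ∑ i ∈ S, I.d i - S.sup I.d

/-- The sets of targets whose aggregate weight is at least `W`. -/
def feasibleSets : Finset (Finset (Fin m)) := {S ∈ I.targets.powerset | I.W ≤ I.weight S}

/-- The optimal offline cost: the minimum of `d_S` over all feasible sets `S` of targets. -/
def opt : ℝ≥0∞ := I.feasibleSets.inf I.setCost

/-- `s_I`: the largest cardinality of a feasible set of targets of optimal cost. -/
def optCard : ℕ := ({S ∈ I.feasibleSets | I.setCost S = I.opt} : Finset (Finset (Fin m))).sup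
  Finset.card

end WSInstance

/-- The record of one exploration: the ray, the prescribed depth, and either `none` (no target was
found) or `some (distance, weight)` of the target that was found. -/
structure Probe (m : ℕ) where
  ray : Fin m
  depth : ℝ≥0∞
  result : Option (ℝ≥0∞ × ℝ≥0)

/-- A deterministic search strategy with memory. Whenever the searcher is at the origin, the
strategy looks at the weight objective and at the chronological list of all explorations made so
far, and answers with a ray and a depth (possibly infinite), or with `none`: stay at the origin. -/
def Strategy (m : ℕ) : Type := ℝ≥0 → List (Probe m) → Option (Fin m × ℝ≥0∞)

/-- The situation after a number of explorations. -/
structure SearchState (m : ℕ) where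
  /-- the explorations made so far, in chronological order -/
  hist : List (Probe m)
  /-- the rays whose targets have been found -/
  found : Finset (Fin m)
  /-- the distance traversed until the searcher turned back in the last exploration -/
  turn : ℝ≥0∞
  /-- the distance traversed until the searcher was back at the origin -/
  home : ℝ≥0∞

namespace Strategy

variable {m : ℕ}

/-- One exploration. The searcher turns back at the target if it lies within the prescribed depth,
and at that depth otherwise. A ray whose target has been found is never traversed again: choosing
it has no effect on the search. -/
def step (Sg : Strategy m) (I : WSInstance m) (st : SearchState m) : SearchState m :=
  match Sg I.W st.hist with
  | none => st
  | some (r, l) =>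
    if r ∈ st.found then
      { st with hist := st.hist ++ [⟨r, l, none⟩] }
    else if I.d r ≠ ⊤ ∧ I.d r ≤ l then
      { hist := st.hist ++ [⟨r, l, some (I.d r, I.w r)⟩]
        found := insert r st.found
        turn := st.home + I.d r
        home := st.home + 2 * I.d r }
    else
      { hist := st.hist ++ [⟨r, l, none⟩]
        found := st.found
        turn := st.home + l
        home := st.home + 2 * l }

/-- The situation after `n` explorations. -/
def run (Sg : Strategy m) (I : WSInstance m) : ℕ → SearchState m
  | 0 => { hist := [], found := ∅, turn := 0, home := 0 }
  | n + 1 => Sg.step I (Sg.run I n)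

open Classical in
/-- `c(Σ, I)`: the total distance traversed until the targets found first have aggregate weight at
least `W`, and `⊤` if this never happens. -/
def cost (Sg : Strategy m) (I : WSInstance m) : ℝ≥0∞ :=
  if h : ∃ n, I.W ≤ I.weight (Sg.run I n).found then (Sg.run I (Nat.find h)).turn else ⊤

end Strategy

/-- The variables of the adaptive strategy. The remaining rays are kept in canonical order, so that
the remaining ray with label `j` is the `j`-th entry of `rays`. -/
structure AdState (m : ℕ) where
  rays : List (Fin m)
  f : ℕ
  r : ℕ
  D : ℝ≥0∞

namespace AdState

variable {m : ℕ}

/-- `f ← 1`, `r ← 0`, `D ← 1`, and all rays remain. -/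
def init (m : ℕ) : AdState m := { rays := List.finRange m, f := 1, r := 0, D := 1 }

/-- `b_{m,f} = 1 + 1/(m - f)`. For `f = m` it is infinite: the only remaining ray is searched
until its target is found. -/
def base (a : AdState m) : ℝ≥0∞ := 1 + ((m - a.f : ℕ) : ℝ≥0∞)⁻¹

/-- The update after an exploration. If no target was found: `r ← r + 1 (mod m - f + 1)` and
`D ← D * b_{m,f}`. Otherwise: `f ← f + 1`, the `r`-th ray is removed, the remaining ones are
relabelled, and `r ← r (mod m - f + 1)` for the new `f`. -/
def update (a : AdState m) : Option (ℝ≥0∞ × ℝ≥0) → AdState m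
  | none => { rays := a.rays, f := a.f, r := (a.r + 1) % (m + 1 - a.f), D := a.D * a.base }
  | some _ =>
    { rays := a.rays.eraseIdx a.r, f := a.f + 1, r := a.r % (m + 1 - (a.f + 1)), D := a.D }

/-- The next exploration: the `r`-th remaining ray, to depth `D * b_{m,f}`. -/
def next (a : AdState m) : Option (Fin m × ℝ≥0∞) := a.rays[a.r]?.map fun i => (i, a.D * a.base)

end AdState

/-- The adaptive strategy `AdSch`: it runs the adaptive subset strategy until targets of aggregate
weight at least `W` have been found. -/
def adSch (m : ℕ) : Strategy m := fun _ h =>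
  (h.foldl (fun a p => a.update p.result) (AdState.init m)).next

end

/-! ### Searching for a single target on several rays -/

noncomputable section

/-! Upper bound. Fix a feasible set `S` of targets and call its members relevant. Let `M + 1` rays
remain, let `g` irrelevant targets have been found, and put `N = M + g`. For the ray at position `j`
of the queue, whose target is no nearer than `x`, half of the distance traversed is at most `(N + 1)
x (1 + 1/N)^(N - j)` plus a charge of `(1 + e) d` for every relevant target found, `d` being its
distance. A failure or an irrelevant find leaves `N` unchanged, and the cost of the exploration is
paid by the ray advancing in the queue (`RayBound.step_cost`). A relevant find lowers `N` by one;
the loss is at most the search depth `D ≤ e d`, and the charge covers it (`RayBound.relevant`). In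
the last exploration the bound is applied to the nearest missing relevant target, at distance `y`.
If `v + 1` relevant targets are missing, then `N = m - |S| + v`, and `le_ratioBound_mul` spreads the
cost over these `v + 1` targets, all at distance at least `y` (`AdInv.turn_le`).

Lower bound for `s < m`. With `s - 1` necessary targets at distance 1 and the last one on any of the
other `n = m - s + 1` rays, the ratio is asymptotically that of searching `n` rays for one target.
Sorted by depth, the explorations that set a record on their ray have partial sums with `T (k + n) ≤
L (T (k + 1) - T k)` up to an additive constant. This forces a growth rate `q` with `q^n ≤ L (q -
1)`, and the minimum of `q^n / (q - 1)` is `n^n / (n - 1)^(n - 1)` (`le_of_linear_recurrence`,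
`ray_search_lower_bound`).

Lower bound for `s = m`. The adversary watches the search while nothing is found. Once some ray has
been explored deeply, targets just beyond all explored depths make the walk so far at least the
optimum, which is then still to be paid. A strategy that goes infinitely deep first is met by one
very distant target, from which it must walk back. A strategy that does neither never reaches
targets at distance `2m`. -/

theorem pow_mul_sub_one_le {n : ℕ} (hn : 2 ≤ n) {q : ℝ} (hq : 0 ≤ q) :
    n * (1 + 1 / ((n : ℝ) - 1)) ^ (n - 1) * (q - 1) ≤ q ^ n := by
  obtain ⟨k, rfl⟩ : ∃ k, n = k + 1 := ⟨n - 1, by omega⟩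
  have hk : (0 : ℝ) < k := by exact_mod_cast (show 0 < k by omega)
  have hk1 : (0 : ℝ) < k + 1 := by linarith
  -- The minimiser of `q^n / (q - 1)` is `q = n / (n - 1)`, which this rescaling sends to `z = 1`;
  -- Bernoulli's inequality is the tangent there.
  set z : ℝ := q * k / (k + 1) with hz
  have hz0 : 0 ≤ z := by positivity
  have hB : 1 + ((k + 1 : ℕ) : ℝ) * (z - 1) ≤ z ^ (k + 1) :=
    one_add_mul_sub_le_pow (by linarith) _
  have hqz : q = z * (1 + 1 / (k : ℝ)) := by rw [hz]; field_simp
  have hsub : ((k + 1 : ℕ) : ℝ) - 1 = k := by push_cast; ring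
  rw [hsub, Nat.add_sub_cancel]
  set c : ℝ := 1 + 1 / (k : ℝ) with hc
  have hc0 : 0 < c := by positivity
  have hkc : ((k + 1 : ℕ) : ℝ) = k * c := by rw [hc]; push_cast; field_simp
  have h1 : ((k + 1 : ℕ) : ℝ) * (q - 1) = c * (1 + ((k + 1 : ℕ) : ℝ) * (z - 1)) := by
    have : ((k : ℝ) * c - 1 - k) = 0 := by rw [← hkc]; push_cast; ring
    rw [hkc, hqz]
    linear_combination c * this
  calc ((k + 1 : ℕ) : ℝ) * c ^ k * (q - 1) = c ^ k * (((k + 1 : ℕ) : ℝ) * (q - 1)) := by ring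
    _ = c ^ (k + 1) * (1 + ((k + 1 : ℕ) : ℝ) * (z - 1)) := by rw [h1]; ring
    _ ≤ c ^ (k + 1) * z ^ (k + 1) := by gcongr
    _ = q ^ (k + 1) := by rw [hqz, mul_pow, mul_comm]

/-- A positive increasing sequence with `T (k + n) ≤ L (T (k + 1) - T k)` forces
`L ≥ n ^ n / (n - 1) ^ (n - 1)`. -/
theorem le_of_linear_recurrence {n : ℕ} (hn : 2 ≤ n) {T : ℕ → ℝ} {L : ℝ} (hpos : ∀ k, 0 < T k)
    (hmono : Monotone T) (h : ∀ k, T (k + n) ≤ L * (T (k + 1) - T k)) :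
    n * (1 + 1 / ((n : ℝ) - 1)) ^ (n - 1) ≤ L := by
  set q : ℝ := ⨅ k, T (k + 1) / T k with hq
  have hbdd : BddBelow (Set.range fun k => T (k + 1) / T k) :=
    ⟨1, by rintro _ ⟨k, rfl⟩; exact (one_le_div (hpos k)).2 (hmono (Nat.le_succ k))⟩
  have hq1 : 1 ≤ q := le_ciInf fun k => (one_le_div (hpos k)).2 (hmono (Nat.le_succ k))
  have hstep : ∀ k, q * T k ≤ T (k + 1) := fun k => (le_div_iff₀ (hpos k)).1 (ciInf_le hbdd k)
  have hpow : ∀ j k, q ^ j * T k ≤ T (k + j) := by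
    intro j k
    induction j with
    | zero => simp
    | succ j ih =>
      calc q ^ (j + 1) * T k = q * (q ^ j * T k) := by ring
        _ ≤ q * T (k + j) := by gcongr
        _ ≤ T (k + (j + 1)) := hstep _
  have hkey : ∀ k, q ^ (n - 1) * T (k + 1) ≤ L * (T (k + 1) - T k) := by
    intro k
    refine le_trans ?_ (h k)
    have := hpow (n - 1) (k + 1)
    rwa [show k + 1 + (n - 1) = k + n by omega] at this
  have hL : 0 < L := by
    by_contra hL
    have h1 := hkey 0
    have h2 : 0 < q ^ (n - 1) * T (0 + 1) := mul_pos (by positivity) (hpos _)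
    nlinarith [hmono (Nat.le_succ 0)]
  have hlt : q ^ (n - 1) < L := by
    have h1 := hkey 0
    have h3 := mul_pos hL (hpos 0)
    by_contra hc
    nlinarith [hpos (0 + 1)]
  -- By `hkey` every ratio `T (k + 1) / T k` is at least `L / (L - q ^ (n - 1))`, hence so is their
  -- infimum. Clearing the denominator yields `q ^ n ≤ L (q - 1)`.
  have hq2 : L / (L - q ^ (n - 1)) ≤ q := by
    refine le_ciInf fun k => ?_
    rw [div_le_div_iff₀ (by linarith) (hpos k)]
    nlinarith [hkey k]
  rw [div_le_iff₀ (by linarith)] at hq2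
  have hqn : q ^ n = q * q ^ (n - 1) := by
    rw [← pow_succ']; congr 1; omega
  have hfin : q ^ n ≤ L * (q - 1) := by rw [hqn]; linarith
  have hb := pow_mul_sub_one_le hn (by linarith : 0 ≤ q)
  have hqgt : 1 < q := by
    have : 0 < q ^ n := by positivity
    by_contra hc
    nlinarith
  exact le_of_mul_le_mul_right (hb.trans hfin) (by linarith)

/-- An infinite set on which `l` has finite sublevel sets can be enumerated by increasing values. -/
theorem exists_increasing_enumeration {R : Set ℕ} {l : ℕ → ℝ}
    (hfin : ∀ x, {k ∈ R | l k ≤ x}.Finite) (hunb : ∀ x, ∃ k ∈ R, x < l k) :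
    ∃ σ : ℕ → ℕ, Function.Injective σ ∧ (∀ k, σ k ∈ R) ∧
      ∀ k, ∀ b ∈ R, (∀ i < k, σ i ≠ b) → l (σ k) ≤ l b := by
  classical
  have hpick : ∀ A : Finset ℕ, ∃ a ∈ R, a ∉ A ∧ ∀ b ∈ R, b ∉ A → l a ≤ l b := by
    intro A
    obtain ⟨x, hx⟩ := A.finite_toSet.image l |>.bddAbove
    obtain ⟨k, hkR, hk⟩ := hunb x
    have hkA : k ∉ A := fun h => absurd (hx ⟨k, h, rfl⟩) (not_le.2 hk)
    have hF : {i ∈ R | l i ≤ l k ∧ i ∉ A}.Finite := (hfin (l k)).subset fun i hi => ⟨hi.1, hi.2.1⟩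
    obtain ⟨a, ha, hmin⟩ := Set.exists_min_image _ l hF ⟨k, hkR, le_rfl, hkA⟩
    refine ⟨a, ha.1, ha.2.2, fun b hb hbA => ?_⟩
    by_cases hbk : l b ≤ l k
    · exact hmin b ⟨hb, hbk, hbA⟩
    · exact ha.2.1.trans (not_le.1 hbk).le
  choose p hpR hpA hpmin using hpick
  let A : ℕ → Finset ℕ := fun k => Nat.rec ∅ (fun _ B => insert (p B) B) k
  have hA : ∀ k, A k = (Finset.range k).image fun i => p (A i) := by
    intro k
    induction k with
    | zero => rfl
    | succ k ih =>
      rw [Finset.range_add_one, Finset.image_insert, ← ih]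
  have hmem : ∀ i k, i < k → p (A i) ∈ A k := fun i k h => by
    rw [hA k]; exact Finset.mem_image_of_mem _ (Finset.mem_range.2 h)
  refine ⟨fun k => p (A k), ?_, fun k => hpR _, fun k b hb hbk => hpmin _ b hb ?_⟩
  · intro i k hik
    rcases lt_trichotomy i k with h | h | h
    · exact absurd (by simpa only [← hik] using hmem i k h) (hpA (A k))
    · exact h
    · exact absurd (by simpa only [hik] using hmem k i h) (hpA (A i))
  · rw [hA k]
    simpa using fun i hi => hbk i hi

/-- A greedy comparison: of `q + 1` elements of `B`, one is missed by the first `q` values of `σ`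
from `k` on, so it was still available when `σ (k + q)` was chosen as the smallest. -/
theorem sum_enumeration_le {R : Set ℕ} {l : ℕ → ℝ} {σ : ℕ → ℕ}
    (hmin : ∀ k, ∀ b ∈ R, (∀ i < k, σ i ≠ b) → l (σ k) ≤ l b) (k : ℕ) :
    ∀ (q : ℕ) (B : Finset ℕ), B.card = q → (∀ b ∈ B, b ∈ R ∧ ∀ i < k, σ i ≠ b) →
      ∑ i ∈ Finset.range q, l (σ (k + i)) ≤ ∑ b ∈ B, l b := by
  classical
  intro q
  induction q with
  | zero => intro B hB _; simp [Finset.card_eq_zero.1 hB]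
  | succ q ih =>
    intro B hB hBR
    obtain ⟨b, hb, hbn⟩ : ∃ b ∈ B, b ∉ (Finset.range q).image fun i => σ (k + i) := by
      by_contra hc
      push Not at hc
      have := (Finset.card_le_card hc).trans Finset.card_image_le
      simp [hB] at this
    rw [Finset.sum_range_succ, ← Finset.sum_erase_add _ _ hb]
    refine add_le_add (ih _ ?_ fun c hc => hBR c (Finset.mem_of_mem_erase hc)) ?_
    · rw [Finset.card_erase_of_mem hb, hB]; rfl
    · refine hmin _ b (hBR b hb).1 fun i hi h => ?_
      by_cases hik : i < k
      · exact (hBR b hb).2 i hik h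
      · exact hbn (Finset.mem_image.2 ⟨i - k, Finset.mem_range.2 (by omega), by
          rw [← h]; congr 1; omega⟩)

/-- The lower bound for searching one target on the rays of `F`. The `k`-th exploration is on ray
`r k` to depth `l k`; the hypothesis says that points just beyond distance `y` are found before the
total depth exceeds `L y + C`. -/
theorem ray_search_lower_bound {ι : Type*} [DecidableEq ι] {F : Finset ι} (hF : 2 ≤ F.card)
    {r : ℕ → ι} {l : ℕ → ℝ} (hl : ∀ k, 0 ≤ l k) {L C : ℝ} (hL : 0 ≤ L)
    (h : ∀ j ∈ F, ∀ y : ℝ, 1 ≤ y →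
      ∃ k, r k = j ∧ y < l k ∧ ∑ i ∈ Finset.range k, l i ≤ L * y + C) :
    F.card * (1 + 1 / ((F.card : ℝ) - 1)) ^ (F.card - 1) ≤ L := by
  classical
  have hfirst : ∀ j ∈ F, ∀ y : ℝ, 1 ≤ y → ∃ k, r k = j ∧ y < l k ∧
      ∑ i ∈ Finset.range k, l i ≤ L * y + C ∧ ∀ i < k, r i = j → l i ≤ y := by
    intro j hj y hy
    have hex : ∃ k, r k = j ∧ y < l k := by
      obtain ⟨k, h1, h2, -⟩ := h j hj y hy; exact ⟨k, h1, h2⟩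
    refine ⟨Nat.find hex, (Nat.find_spec hex).1, (Nat.find_spec hex).2, ?_, fun i hi hij => ?_⟩
    · obtain ⟨k, h1, h2, h3⟩ := h j hj y hy
      refine le_trans (Finset.sum_le_sum_of_subset_of_nonneg ?_ fun i _ _ => hl i) h3
      exact Finset.range_subset_range.2 (Nat.find_min' hex ⟨h1, h2⟩)
    · by_contra hc
      exact Nat.find_min hex hi ⟨hij, not_le.1 hc⟩
  choose! J hJr hJl hJs hJm using hfirst
  -- The record explorations. A record of depth at most `y` precedes the first exploration `J` of
  -- its ray beyond `y`; this makes the sublevel sets of `R` finite.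
  set R : Set ℕ := {k | r k ∈ F ∧ 1 < l k ∧ ∀ i < k, r i = r k → l i < l k} with hR
  have hJR : ∀ j ∈ F, ∀ y : ℝ, 1 ≤ y → J j y ∈ R := by
    intro j hj y hy
    refine ⟨by rwa [hJr j hj y hy], hy.trans_lt (hJl j hj y hy), fun i hi hij => ?_⟩
    exact (hJm j hj y hy i hi (by rw [hij, hJr j hj y hy])).trans_lt (hJl j hj y hy)
  have hRJ : ∀ k ∈ R, ∀ y : ℝ, 1 ≤ y → l k ≤ y → k < J (r k) y := by
    intro k hk y hy hky
    by_contra hc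
    have hlt := hJl _ hk.1 y hy
    rcases (not_lt.1 hc).lt_or_eq with h' | h'
    · have := hk.2.2 _ h' (hJr _ hk.1 y hy)
      linarith
    · rw [h'] at hlt; linarith
  have hFne : F.Nonempty := Finset.card_pos.1 (by omega)
  have hfin : ∀ x, {k ∈ R | l k ≤ x}.Finite := by
    intro x
    refine (Finset.finite_toSet (Finset.range (F.sup fun j => J j (max x 1)))).subset ?_
    rintro k ⟨hk, hkx⟩
    have h1 := hRJ k hk (max x 1) (le_max_right _ _) (hkx.trans (le_max_left _ _))
    exact Finset.mem_coe.2 (Finset.mem_range.2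
      (h1.trans_le (Finset.le_sup (f := fun j => J j (max x 1)) hk.1)))
  have hunb : ∀ x, ∃ k ∈ R, x < l k := by
    intro x
    obtain ⟨j, hj⟩ := hFne
    exact ⟨J j (max x 1), hJR j hj _ (le_max_right _ _),
      (le_max_left x 1).trans_lt (hJl j hj _ (le_max_right _ _))⟩
  obtain ⟨σ, hinj, hσR, hmin⟩ := exists_increasing_enumeration hfin hunb
  have hσmono : ∀ i k, i ≤ k → l (σ i) ≤ l (σ k) := fun i k hik =>
    hmin i _ (hσR k) fun a ha he => by have := hinj he; omega
  -- Let `y j` be the largest depth in `A` on ray `j`, or 1. Each ray has a first exploration beyond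
  -- `y j`. Before the latest of these, on ray `j₀`, all of `A` and the `F.card - 1` others have
  -- taken place, and their total is bounded by the hypothesis at `y j₀ ≤ x`.
  have hset : ∀ (A : Finset ℕ) (x : ℝ), 1 ≤ x → (∀ a ∈ A, a ∈ R ∧ l a ≤ x) →
      ∃ B : Finset ℕ, B.card = F.card - 1 ∧ (∀ b ∈ B, b ∈ R ∧ b ∉ A) ∧
        ∑ a ∈ A, l a + ∑ b ∈ B, l b ≤ L * x + C := by
    intro A x hx hA
    have hy : ∀ j, ∃ y : ℝ, 1 ≤ y ∧ y ≤ x ∧ ∀ a ∈ A, r a = j → l a ≤ y := by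
      intro j
      rcases (A.filter fun a => r a = j).eq_empty_or_nonempty with h0 | h0
      · exact ⟨1, le_rfl, hx, fun a ha haj => absurd (h0 ▸ Finset.mem_filter.2 ⟨ha, haj⟩ : a ∈ (∅ : Finset ℕ)) (by simp)⟩
      · obtain ⟨a, ha, hmax⟩ := Finset.exists_max_image _ l h0
        rw [Finset.mem_filter] at ha
        exact ⟨l a, (hA a ha.1).1.2.1.le, (hA a ha.1).2, fun b hb hbj =>
          hmax b (Finset.mem_filter.2 ⟨hb, hbj⟩)⟩
    choose y hy1 hyx hyA using hy
    obtain ⟨j₀, hj₀, hmax⟩ := Finset.exists_max_image F (fun j => J j (y j)) hFne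
    have hJinj : Set.InjOn (fun j => J j (y j)) F := by
      intro i hi j hj hij
      have h1 := hJr i hi _ (hy1 i)
      have h2 := hJr j hj _ (hy1 j)
      simp only at hij
      rw [← h1, ← h2, hij]
    have hJA : ∀ j ∈ F, J j (y j) ∉ A := fun j hj hm =>
      absurd (hyA j _ hm (hJr j hj _ (hy1 j))) (not_le.2 (hJl j hj _ (hy1 j)))
    refine ⟨(F.erase j₀).image fun j => J j (y j), ?_, ?_, ?_⟩
    · rw [Finset.card_image_of_injOn (hJinj.mono (by simp)),
        Finset.card_erase_of_mem hj₀]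
    · intro b hb
      obtain ⟨j, hj, rfl⟩ := Finset.mem_image.1 hb
      have hj := Finset.mem_of_mem_erase hj
      exact ⟨hJR j hj _ (hy1 j), hJA j hj⟩
    · rw [← Finset.sum_union]
      · refine le_trans (Finset.sum_le_sum_of_subset_of_nonneg (t := Finset.range (J j₀ (y j₀)))
          ?_ fun i _ _ => hl i) ((hJs j₀ hj₀ _ (hy1 j₀)).trans (by gcongr; exact hyx _))
        intro a ha
        rw [Finset.mem_range]
        rcases Finset.mem_union.1 ha with ha | ha
        · exact (hRJ a (hA a ha).1 _ (hy1 _) (hyA _ a ha rfl)).trans_le (hmax _ (hA a ha).1.1)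
        · obtain ⟨j, hj, rfl⟩ := Finset.mem_image.1 ha
          refine lt_of_le_of_ne (hmax j (Finset.mem_of_mem_erase hj)) fun he => ?_
          exact Finset.ne_of_mem_erase hj (hJinj (Finset.mem_of_mem_erase hj) hj₀ he)
      · rw [Finset.disjoint_left]
        intro a ha hb
        obtain ⟨j, hj, rfl⟩ := Finset.mem_image.1 hb
        exact hJA j (Finset.mem_of_mem_erase hj) ha
  set T : ℕ → ℝ := fun k => ∑ i ∈ Finset.range k, l (σ i) with hT
  have hrec : ∀ k, T (k + F.card) ≤ L * l (σ k) + C := by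
    intro k
    obtain ⟨B, hBc, hBR, hB⟩ := hset ((Finset.range (k + 1)).image σ) (l (σ k)) (hσR k).2.1.le (by
      intro a ha
      obtain ⟨i, hi, rfl⟩ := Finset.mem_image.1 ha
      exact ⟨hσR i, hσmono i k (by simpa [Nat.lt_succ_iff] using hi)⟩)
    refine le_trans ?_ hB
    rw [Finset.sum_image (fun a _ b _ hab => hinj hab)]
    have h1 := sum_enumeration_le hmin (k + 1) (F.card - 1) B hBc fun b hb =>
      ⟨(hBR b hb).1, fun i hi he => (hBR b hb).2 (Finset.mem_image.2 ⟨i, by simpa using hi, he⟩)⟩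
    have h2 : T (k + F.card) = ∑ i ∈ Finset.range (k + 1), l (σ i) +
        ∑ i ∈ Finset.range (F.card - 1), l (σ (k + 1 + i)) := by
      rw [← Finset.sum_range_add (fun i => l (σ i))]
      simp only [hT]
      congr 2; omega
    rw [h2]; gcongr
  -- The depths `l (σ k)` tend to infinity, so `C` is absorbed into `δ * l (σ k)` from some index
  -- on. Starting the recurrence at `K + 1` also makes the partial sums nonempty, hence positive.
  refine le_of_forall_pos_le_add fun δ hδ => ?_
  obtain ⟨K, hK⟩ : ∃ K, ∀ k, K ≤ k → C ≤ δ * l (σ k) := by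
    have hf : {k | l (σ k) ≤ C / δ}.Finite := by
      refine ((hfin (C / δ)).preimage (f := σ) hinj.injOn).subset ?_
      intro k hk
      exact ⟨hσR k, hk⟩
    obtain ⟨K, hK⟩ := hf.bddAbove
    refine ⟨K + 1, fun k hk => ?_⟩
    by_contra hc
    have : k ≤ K := hK (show l (σ k) ≤ C / δ by
      rw [le_div_iff₀ hδ]; linarith)
    omega
  have hlpos : ∀ k, 0 < l (σ k) := fun k => by linarith [(hσR k).2.1]
  have hTs : ∀ k, T (k + 1) = T k + l (σ k) := fun k => Finset.sum_range_succ _ _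
  refine le_of_linear_recurrence hF (T := fun k => T (k + (K + 1))) (fun k => ?_) ?_ fun k => ?_
  · exact Finset.sum_pos (fun i _ => hlpos _) ⟨0, by simp⟩
  · refine monotone_nat_of_le_succ fun k => ?_
    rw [show k + 1 + (K + 1) = (k + (K + 1)) + 1 by ring, hTs]
    linarith [hlpos (k + (K + 1))]
  · rw [show k + 1 + (K + 1) = (k + (K + 1)) + 1 by ring, hTs,
      show k + F.card + (K + 1) = k + (K + 1) + F.card by ring]
    have h1 := hrec (k + (K + 1))
    have h2 := hK (k + (K + 1)) (by omega)
    linarith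

/-! ### Inequalities for the growth factor -/

/-- The factor `1 + 1/n` by which the search depth grows (with value `1` for `n = 0`). -/
def growth (n : ℕ) : ℝ := 1 + 1 / (n : ℝ)

theorem one_le_growth (n : ℕ) : 1 ≤ growth n := by
  unfold growth; have : (0 : ℝ) ≤ 1 / n := by positivity
  linarith

theorem growth_pos (n : ℕ) : 0 < growth n := by linarith [one_le_growth n]

theorem growth_anti {k n : ℕ} (hk : 1 ≤ k) (h : k ≤ n) : growth n ≤ growth k := by
  unfold growth
  have : (0 : ℝ) < k := by exact_mod_cast hk
  gcongr

theorem succ_mul_growth (n : ℕ) : ((n : ℝ) + 1) * growth (n + 1) = n + 2 := by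
  unfold growth; push_cast
  have : (n : ℝ) + 1 ≠ 0 := by positivity
  field_simp; ring

/-- Bernoulli's inequality, as `(g + 1) / (M + 1 + g) ≥ 1 / (M + 1)`. It bounds one exploration,
whose depth uses the base for the rays that remain, in terms of the base of the accounting, which
also counts irrelevant finds. -/
theorem growth_le_pow (M g : ℕ) : growth (M + 1) ≤ growth (M + 1 + g) ^ (g + 1) := by
  have h1 : 1 + ((g + 1 : ℕ) : ℝ) * (1 / ((M + 1 + g : ℕ) : ℝ)) ≤ growth (M + 1 + g) ^ (g + 1) :=
    one_add_mul_le_pow (by have : (0 : ℝ) ≤ 1 / ((M + 1 + g : ℕ) : ℝ) := by positivity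
                           linarith) _
  refine le_trans ?_ h1
  unfold growth
  push_cast
  rw [mul_one_div]
  have h2 : 1 / ((M : ℝ) + 1) ≤ ((g : ℝ) + 1) / (M + 1 + g) := by
    rw [div_le_div_iff₀ (by positivity) (by positivity)]
    nlinarith [(by positivity : (0 : ℝ) ≤ (M : ℝ) * g)]
  linarith

theorem growth_pow_self_mono : Monotone fun n => growth n ^ n := by
  refine monotone_nat_of_le_succ fun n => ?_
  rcases n with _ | n
  · simpa using one_le_growth 1
  · have h := pow_mul_sub_one_le (n := n + 2) (by omega) (growth_pos (n + 1 + 1)).le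
    have h0 : ((n + 2 : ℕ) : ℝ) - 1 = ((n + 1 : ℕ) : ℝ) := by push_cast; ring
    rw [h0] at h
    have h3 : ((n + 2 : ℕ) : ℝ) * (growth (n + 1 + 1) - 1) = 1 := by
      unfold growth; push_cast
      have : (n : ℝ) + 2 ≠ 0 := by positivity
      field_simp; ring
    calc growth (n + 1) ^ (n + 1) = (growth (n + 1)) ^ (n + 1) *
          (((n + 2 : ℕ) : ℝ) * (growth (n + 1 + 1) - 1)) := by rw [h3, mul_one]
      _ ≤ growth (n + 1 + 1) ^ (n + 2) := by
          refine le_trans (le_of_eq ?_) h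
          simp only [growth, show n + 2 - 1 = n + 1 by omega]
          ring

theorem growth_pow_self_le (n : ℕ) : growth n ^ n ≤ Real.exp 1 := by
  rcases n with _ | n
  · simp
  · have h := Real.one_sub_inv_le_log_of_pos (growth_pos (n + 1))
    have h1 : growth (n + 1) ≤ Real.exp (1 / ((n + 1 : ℕ) : ℝ)) := by
      unfold growth; linarith [Real.add_one_le_exp (1 / ((n + 1 : ℕ) : ℝ))]
    calc growth (n + 1) ^ (n + 1) ≤ Real.exp (1 / ((n + 1 : ℕ) : ℝ)) ^ (n + 1) :=
          pow_le_pow_left₀ (growth_pos _).le h1 _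
      _ = Real.exp 1 := by
          rw [← Real.exp_nat_mul]; congr 1
          have : ((n + 1 : ℕ) : ℝ) ≠ 0 := by positivity
          field_simp

/-- Raising the index increases `growth n ^ n` and decreases `growth n ^ t`; divide one by the
other. -/
theorem growth_pow_sub_le {M N t : ℕ} (hMN : M ≤ N) (ht : t ≤ M) :
    growth M ^ (M - t) ≤ growth N ^ (N - t) := by
  rcases Nat.eq_zero_or_pos M with rfl | hM
  · simpa using one_le_pow₀ (one_le_growth N)
  · have h1 : growth M ^ M ≤ growth N ^ N := growth_pow_self_mono hMN
    have h2 : growth N ^ t ≤ growth M ^ t := pow_le_pow_left₀ (growth_pos _).le (growth_anti hM hMN) _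
    have h3 : 0 < growth M ^ t := pow_pos (growth_pos _) _
    refine le_of_mul_le_mul_right ?_ h3
    calc growth M ^ (M - t) * growth M ^ t = growth M ^ M := by rw [← pow_add]; congr 1; omega
      _ ≤ growth N ^ N := h1
      _ = growth N ^ (N - t) * growth N ^ t := by rw [← pow_add]; congr 1; omega
      _ ≤ growth N ^ (N - t) * growth M ^ t := by
          have := (pow_pos (growth_pos N) (N - t)).le
          gcongr

/-- Raising `g` to `g + 1` adds `growth (n + 1) ^ (g + 1)` on the left and the larger `growth n ^ (g
+ 1)` on the right. The case `n = 0` with `g > 0` must be excluded, because `growth 0 = 1`. -/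
theorem mul_growth_pow_le {n g : ℕ} (h : 1 ≤ n ∨ g = 0) :
    ((n : ℝ) + 2) * growth (n + 1) ^ g ≤ ((n : ℝ) + 1) * growth n ^ g + 1 := by
  rcases h with h | rfl
  · obtain ⟨k, rfl⟩ : ∃ k, n = k + 1 := ⟨n - 1, by omega⟩
    induction g with
    | zero => push_cast; simp; linarith
    | succ g ih =>
      have e1 := succ_mul_growth k
      have e2 := succ_mul_growth (k + 1)
      have h1 : growth (k + 1 + 1) ^ (g + 1) ≤ growth (k + 1) ^ (g + 1) :=
        pow_le_pow_left₀ (growth_pos _).le (growth_anti (by omega) (by omega)) _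
      push_cast at *
      have a1 : growth (k + 1 + 1) ^ g * ((k : ℝ) + 1 + 2) =
        growth (k + 1 + 1) ^ g * (((k : ℝ) + 1 + 1) * growth (k + 1 + 1)) := by rw [e2]
      have a2 : growth (k + 1) ^ g * ((k : ℝ) + 1 + 1) =
        growth (k + 1) ^ g * (((k : ℝ) + 1) * growth (k + 1)) := by rw [e1]; ring
      rw [pow_succ, pow_succ] at *
      nlinarith
  · simp; linarith

/-! ### Accounting for the distance traversed -/

/-- The accounting for one of the `M + 1` rays that remain, the one at position `j` of the queue: it
has been explored to depth `x`, the current search depth is `D`, half of the distance traversed is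
`h`, of which `K` is charged to relevant targets, and `g` irrelevant targets have been found. -/
structure RayBound (M g : ℕ) (D h K : ℝ) (j : ℕ) (x : ℝ) : Prop where
  one_le : 1 ≤ x
  le_depth : x ≤ D
  depth_le : D ≤ x * growth M ^ (M - j)
  cost_le : h ≤ ((M + g : ℕ) + 1) * x * growth (M + g) ^ (M + g - j) + K

/-- The accounting in terms of the current search depth. -/
def TotalBound (M g : ℕ) (D h K : ℝ) : Prop :=
  h ≤ ((M + g : ℕ) + 1) * growth (M + g) ^ g * D + K

theorem depth_le_of_next {M j : ℕ} {D x : ℝ} (hx : 0 ≤ x) (hj : j ≤ M)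
    (h : D ≤ x * growth (M + 1) ^ (M + 1 - (j + 1))) : D ≤ x * growth M ^ (M - j) := by
  refine h.trans ?_
  rw [Nat.add_sub_add_right]
  rcases Nat.eq_zero_or_pos M with rfl | hM
  · simp
  · have := growth_anti hM (Nat.le_succ M)
    have := (growth_pos (M + 1)).le
    gcongr

/-- Here `M + g` drops by one. By `mul_growth_pow_le` the main term loses at most `x ≤ D ≤ e d`;
together with the distance `d` itself this is the increase of the charge. -/
theorem RayBound.relevant {M g j : ℕ} {D h K x d : ℝ} (H : RayBound (M + 1) g D h K (j + 1) x)
    (hj : j ≤ M) (hd : D ≤ Real.exp 1 * d) :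
    RayBound M g D (h + d) (K + (1 + Real.exp 1) * d) j x := by
  have hx : 0 ≤ x := by linarith [H.one_le]
  refine ⟨H.one_le, H.le_depth, depth_le_of_next hx hj H.depth_le, ?_⟩
  have h1 := H.cost_le
  rw [show M + 1 + g - (j + 1) = M + g - j by omega, show M + 1 + g = M + g + 1 by ring] at h1
  have h2 := mul_growth_pow_le (n := M + g) (g := M + g - j) (by omega)
  have h3 := mul_le_mul_of_nonneg_right h2 hx
  have := H.le_depth
  push_cast at *
  nlinarith

theorem TotalBound.relevant {M g : ℕ} {D h K d : ℝ} (H : TotalBound (M + 1) g D h K) (hD : 0 ≤ D)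
    (hd : D ≤ Real.exp 1 * d) :
    TotalBound M g D (h + d) (K + (1 + Real.exp 1) * d) := by
  unfold TotalBound at *
  rw [show M + 1 + g = M + g + 1 by ring] at H
  have h2 := mul_growth_pow_le (n := M + g) (g := g) (by omega)
  have h3 := mul_le_mul_of_nonneg_right h2 hD
  push_cast at *
  nlinarith

theorem RayBound.step_depth {M g j : ℕ} {D h K x : ℝ} (H : RayBound (M + 1) g D h K (j + 1) x)
    (hj : j ≤ M) : D * growth (M + 1) ≤ x * growth (M + 1) ^ (M + 1 - j) := by
  have := mul_le_mul_of_nonneg_right H.depth_le (growth_pos (M + 1)).le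
  rwa [mul_assoc, ← pow_succ, show M + 1 - (j + 1) + 1 = M + 1 - j by omega] at this

/-- With `N = M + 1 + g`, the identity `N * growth N = N + 1` shows that advancing one position
raises the main term by exactly `x * growth N ^ (N - j)`. This dominates the search depth, by
`step_depth` and `growth_pow_sub_le`. -/
theorem RayBound.step_cost {M g j : ℕ} {D h K x d : ℝ} (H : RayBound (M + 1) g D h K (j + 1) x)
    (hj : j ≤ M) (hd : d ≤ D * growth (M + 1)) :
    h + d ≤ ((M + 1 + g : ℕ) + 1) * x * growth (M + 1 + g) ^ (M + 1 + g - j) + K := by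
  have hx : 0 ≤ x := by linarith [H.one_le]
  have h1 := H.cost_le
  have h2 := H.step_depth hj
  have h3 : growth (M + 1) ^ (M + 1 - j) ≤ growth (M + 1 + g) ^ (M + 1 + g - j) :=
    growth_pow_sub_le (by omega) (by omega)
  have h4 := mul_le_mul_of_nonneg_left h3 hx
  have e : growth (M + 1 + g) ^ (M + 1 + g - j) =
      growth (M + 1 + g) ^ (M + 1 + g - (j + 1)) * growth (M + 1 + g) := by
    rw [← pow_succ]; congr 1; omega
  have e2 : ((M + 1 + g : ℕ) : ℝ) * growth (M + 1 + g) = (M + 1 + g : ℕ) + 1 := by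
    have := succ_mul_growth (M + g)
    rw [show M + 1 + g = M + g + 1 by ring]; push_cast at *; linarith
  set P := growth (M + 1 + g) ^ (M + 1 + g - (j + 1))
  have e3 : (((M + 1 + g : ℕ) : ℝ) + 1) * x * growth (M + 1 + g) ^ (M + 1 + g - j) =
      (((M + 1 + g : ℕ) : ℝ) + 1) * x * P + x * growth (M + 1 + g) ^ (M + 1 + g - j) := by
    rw [e]; linear_combination (x * P) * e2
  linarith

theorem RayBound.irrelevant {M g j : ℕ} {D h K x d : ℝ} (H : RayBound (M + 1) g D h K (j + 1) x)
    (hj : j ≤ M) (hd : d ≤ D * growth (M + 1)) : RayBound M (g + 1) D (h + d) K j x := by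
  have hx : 0 ≤ x := by linarith [H.one_le]
  refine ⟨H.one_le, H.le_depth, depth_le_of_next hx hj H.depth_le, ?_⟩
  have := H.step_cost hj hd
  rwa [show M + (g + 1) = M + 1 + g by ring]

theorem mul_growth_pow_succ (n g : ℕ) :
    ((n : ℝ) + 2) * growth (n + 1) ^ (g + 1) =
      ((n : ℝ) + 2) * growth (n + 1) ^ g + growth (n + 1) ^ (g + 1) := by
  have e := succ_mul_growth n
  rw [pow_succ]
  linear_combination growth (n + 1) ^ g * e

theorem TotalBound.irrelevant {M g : ℕ} {D h K d : ℝ} (H : TotalBound (M + 1) g D h K) (hD : 0 ≤ D)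
    (hd : d ≤ D * growth (M + 1)) : TotalBound M (g + 1) D (h + d) K := by
  unfold TotalBound at *
  have h1 := mul_le_mul_of_nonneg_left (growth_le_pow M g) hD
  have h2 := mul_growth_pow_succ (M + g) g
  rw [show M + (g + 1) = M + g + 1 by ring]
  rw [show M + 1 + g = M + g + 1 by ring] at *
  push_cast at *
  have h3 := congrArg (· * D) h2
  nlinarith

theorem RayBound.fail {M g j : ℕ} {D h K x : ℝ} (H : RayBound (M + 1) g D h K (j + 1) x)
    (hj : j ≤ M) :
    RayBound (M + 1) g (D * growth (M + 1)) (h + D * growth (M + 1)) K j x := by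
  have hx := H.one_le
  have h2 := H.le_depth
  refine ⟨hx, ?_, H.step_depth hj, H.step_cost hj le_rfl⟩
  nlinarith [one_le_growth (M + 1)]

/-- Multiplying `D` by `b = growth (M + 1)` raises the bound by at least `(M + 2) (b - 1) D = b D`,
the depth just explored. -/
theorem TotalBound.fail {M g : ℕ} {D h K : ℝ} (H : TotalBound (M + 1) g D h K) (hD : 0 ≤ D) :
    TotalBound (M + 1) g (D * growth (M + 1)) (h + D * growth (M + 1)) K := by
  unfold TotalBound at *
  have e := succ_mul_growth M
  have h1 : (1 : ℝ) ≤ growth (M + 1 + g) ^ g := one_le_pow₀ (one_le_growth _)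
  set P := growth (M + 1 + g) ^ g
  set b := growth (M + 1)
  have h2 : b ≤ ((M + 1 + g : ℕ) + 1) * P * (b - 1) := by
    have hb : 0 ≤ b - 1 := by linarith [one_le_growth (M + 1)]
    have : ((M : ℝ) + 2) * 1 * (b - 1) ≤ ((M + 1 + g : ℕ) + 1) * P * (b - 1) := by
      refine mul_le_mul_of_nonneg_right (mul_le_mul ?_ h1 zero_le_one (by positivity)) hb
      push_cast; linarith [(Nat.cast_nonneg g : (0 : ℝ) ≤ g)]
    linarith
  nlinarith [mul_le_mul_of_nonneg_left h2 hD]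

/-- A ray that has just been explored in vain goes to the last position `M` of the queue with `x =
D`; there the two accounts agree. -/
theorem TotalBound.rayBound {M g : ℕ} {D h K : ℝ} (H : TotalBound M g D h K) (hD : 1 ≤ D) :
    RayBound M g D h K M D := by
  refine ⟨hD, le_rfl, by simp, ?_⟩
  unfold TotalBound at H
  rw [show M + g - M = g by omega]
  linarith

/-! ### Numerical estimates for the competitive ratio -/

/-- The factor `1 + 2 (n + 1) (1 + 1/n)^n`, or `3 + 2 e` for `n = 0`. -/
def ratioBound (n : ℕ) : ℝ :=
  if n = 0 then 3 + 2 * Real.exp 1 else 1 + 2 * (n + 1) * growth n ^ n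

theorem two_le_growth_pow {n : ℕ} (hn : 1 ≤ n) : 2 ≤ growth n ^ n := by
  have := growth_pow_self_mono hn
  simp only [growth, pow_one, Nat.cast_one] at this
  unfold growth
  linarith

theorem le_ratioBound (n : ℕ) : 2 * (1 + Real.exp 1) ≤ ratioBound n := by
  unfold ratioBound
  split_ifs with h
  · linarith
  · have h1 := two_le_growth_pow (n := n) (by omega)
    have h2 := Real.exp_one_lt_d9
    have h3 : (1 : ℝ) ≤ n := by exact_mod_cast (by omega : 1 ≤ n)
    nlinarith

/-- For `n > 0` and `v = 0` this is an equality; otherwise the power on the left is at most `e`, and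
`growth n ^ n ≥ 2` for `n ≥ 1` leaves enough room. The summand `-1` is reserved for the final
one-way walk. -/
theorem le_ratioBound_mul (n v : ℕ) :
    2 * ((n : ℝ) + v + 1) * growth (n + v) ^ (n + v) ≤ ratioBound n * (v + 1) - 1 := by
  have h2 := Real.exp_one_lt_d9
  have hv : (0 : ℝ) ≤ v := Nat.cast_nonneg v
  have h4 := growth_pow_self_le (n + v)
  have h5 : 0 ≤ growth (n + v) ^ (n + v) := (pow_pos (growth_pos _) _).le
  unfold ratioBound
  split_ifs with h
  · subst h
    simp only [Nat.cast_zero, zero_add] at *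
    nlinarith
  · have h1 := two_le_growth_pow (n := n) (by omega)
    have h3 : (1 : ℝ) ≤ n := by exact_mod_cast (by omega : 1 ≤ n)
    rcases Nat.eq_zero_or_pos v with rfl | hv1
    · simp
    · have hv1 : (1 : ℝ) ≤ v := by exact_mod_cast hv1
      have h6 : 2 * ((n : ℝ) + v + 1) * growth (n + v) ^ (n + v) ≤
          2 * ((n : ℝ) + v + 1) * 2.7182818286 := by gcongr; linarith
      have h7 : ((n : ℝ) + 1) * 2 * (v + 1) ≤ ((n : ℝ) + 1) * growth n ^ n * (v + 1) := by gcongr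
      nlinarith

/-! ### The queue of remaining rays -/

namespace AdState

variable {m : ℕ}

/-- The remaining rays in the order in which they will be explored. -/
def queue (a : AdState m) : List (Fin m) := a.rays.rotate a.r

theorem getElem?_of_queue {a : AdState m} (hr : a.r < a.rays.length) {i : Fin m} {T : List (Fin m)}
    (hq : a.queue = i :: T) : a.rays[a.r]? = some i := by
  have h : (a.rays.rotate a.r)[0]? = some i := by
    have : a.rays.rotate a.r = i :: T := hq
    simp [this]
  rw [List.getElem?_rotate (by omega)] at h
  rwa [Nat.zero_add, Nat.mod_eq_of_lt hr] at h

theorem queue_update_none {a : AdState m} (hlen : a.rays.length = m + 1 - a.f)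
    {i : Fin m} {T : List (Fin m)} (hq : a.queue = i :: T) :
    (a.update none).queue = T ++ [i] := by
  have h : a.rays.rotate a.r = i :: T := hq
  simp only [queue, update]
  rw [← hlen, List.rotate_mod, ← List.rotate_rotate, h]
  simp

/-- The queue is `drop r ++ take r`. Deleting entry `r` and rotating by the same `r` again yields
`drop (r + 1) ++ take r`, the old queue without its head. -/
theorem queue_update_some {a : AdState m} (hlen : a.rays.length = m + 1 - a.f)
    (hr : a.r < a.rays.length) {i : Fin m} {T : List (Fin m)} (hq : a.queue = i :: T)
    (p : ℝ≥0∞ × ℝ≥0) : (a.update (some p)).queue = T := by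
  have h : a.rays.rotate a.r = i :: T := hq
  rw [List.rotate_eq_drop_append_take hr.le, List.drop_eq_getElem_cons hr, List.cons_append,
    List.cons.injEq] at h
  have hl : (a.rays.eraseIdx a.r).length = m + 1 - (a.f + 1) := by
    rw [List.length_eraseIdx_of_lt hr]; omega
  simp only [queue, update]
  rw [← hl, List.rotate_mod, List.eraseIdx_eq_take_drop_succ, ← h.2]
  have h3 : (a.rays.take a.r).length = a.r := by simp [hr.le]
  have h4 := List.rotate_append_length_eq (a.rays.take a.r) (a.rays.drop (a.r + 1))
  rwa [h3] at h4

theorem length_rays_eq (a : AdState m) : a.rays.length = a.queue.length := by simp [queue]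

theorem base_eq {a : AdState m} {M : ℕ} (h : m - a.f = M + 1) :
    a.base = ENNReal.ofReal (growth (M + 1)) := by
  unfold base growth
  rw [h, ENNReal.ofReal_add zero_le_one (by positivity), ENNReal.ofReal_one, one_div,
    ENNReal.ofReal_inv_of_pos (by positivity), ENNReal.ofReal_natCast]

theorem base_eq_top {a : AdState m} (h : m - a.f = 0) : a.base = ⊤ := by
  unfold base
  simp [h]

end AdState

/-! ### Feasible sets and real distances -/

namespace WSInstance

variable {m : ℕ} (I : WSInstance m)

theorem mem_targets {i : Fin m} : i ∈ I.targets ↔ I.d i ≠ ⊤ := by simp [targets]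

theorem mem_feasibleSets {S : Finset (Fin m)} :
    S ∈ I.feasibleSets ↔ S ⊆ I.targets ∧ I.W ≤ I.weight S := by simp [feasibleSets]

theorem targets_mem_feasibleSets : I.targets ∈ I.feasibleSets :=
  I.mem_feasibleSets.2 ⟨subset_rfl, I.feasible⟩

theorem weight_mono {S T : Finset (Fin m)} (h : S ⊆ T) : I.weight S ≤ I.weight T :=
  Finset.sum_le_sum_of_subset h

theorem exists_optimal : ∃ S ∈ I.feasibleSets, I.setCost S = I.opt ∧ S.card = I.optCard := by
  have h1 : ({S ∈ I.feasibleSets | I.setCost S = I.opt} : Finset (Finset (Fin m))).Nonempty := by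
    obtain ⟨S, hS, h⟩ := Finset.exists_mem_eq_inf _ ⟨_, I.targets_mem_feasibleSets⟩ I.setCost
    exact ⟨S, Finset.mem_filter.2 ⟨hS, h.symm⟩⟩
  obtain ⟨S, hS, h⟩ := Finset.exists_mem_eq_sup _ h1 Finset.card
  obtain ⟨h2, h3⟩ := Finset.mem_filter.1 hS
  exact ⟨S, h2, h3, h.symm⟩

theorem sum_le_setCost {S : Finset (Fin m)} (hS : S ⊆ I.targets) :
    ∑ i ∈ S, I.d i ≤ I.setCost S := by
  have hsup : S.sup I.d ≤ ∑ i ∈ S, I.d i :=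
    Finset.sup_le fun i hi => Finset.single_le_sum (f := I.d) (fun _ _ => zero_le) hi
  have hfin : ∑ i ∈ S, I.d i ≠ ⊤ :=
    ENNReal.sum_ne_top.2 fun i hi => I.mem_targets.1 (hS hi)
  unfold setCost
  rw [two_mul]
  exact ENNReal.le_sub_of_add_le_right (ne_top_of_le_ne_top hfin hsup) (by gcongr)

/-- The distance of a target as a real number. -/
def dist (i : Fin m) : ℝ := (I.d i).toReal

theorem dist_nonneg (i : Fin m) : 0 ≤ I.dist i := ENNReal.toReal_nonneg

theorem ofReal_dist {i : Fin m} (h : I.d i ≠ ⊤) : ENNReal.ofReal (I.dist i) = I.d i :=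
  ENNReal.ofReal_toReal h

theorem le_dist {i : Fin m} {x : ℝ} (h : I.d i ≠ ⊤) (hx : ENNReal.ofReal x ≤ I.d i) :
    x ≤ I.dist i := by
  rwa [← I.ofReal_dist h, ENNReal.ofReal_le_ofReal_iff (I.dist_nonneg i)] at hx

end WSInstance

/-! ### The invariant of the adaptive strategy and the upper bound -/

/-- The part of the distance traversed that is charged to relevant targets. -/
def charge {m : ℕ} (I : WSInstance m) (S F : Finset (Fin m)) : ℝ :=
  (1 + Real.exp 1) * ∑ i ∈ F ∩ S, I.dist i

/-- The invariant of the adaptive strategy after `n` explorations: `Q` is the queue of remaining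
rays, `D` the search depth, and `2 h` the distance traversed. -/
structure AdInv {m : ℕ} (I : WSInstance m) (S : Finset (Fin m)) (n : ℕ) (st : SearchState m)
    (a : AdState m) (Q : List (Fin m)) (D h : ℝ) : Prop where
  f_eq : a.f = st.found.card + 1
  len : Q.length + st.found.card = m
  queue_eq : a.queue = Q
  index_lt : Q ≠ [] → a.r < Q.length
  nodup : Q.Nodup
  mem_iff : ∀ i, i ∈ Q ↔ i ∉ st.found
  found_sub : st.found ⊆ I.targets
  depth_eq : a.D = ENNReal.ofReal D
  home_eq : st.home = ENNReal.ofReal (2 * h)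
  one_le_depth : 1 ≤ D
  half_nonneg : 0 ≤ h
  total : TotalBound (Q.length - 1) (st.found \ S).card D h (charge I S st.found)
  ray : ∀ j (hj : j < Q.length), ∃ x,
    RayBound (Q.length - 1) (st.found \ S).card D h (charge I S st.found) j x ∧
      ENNReal.ofReal x ≤ I.d Q[j]
  -- Used only for termination: each exploration either finds a target or multiplies `D` by at least
  -- `1 + 1/m`.
  growth_le : (1 + 1 / (m : ℝ)) ^ n ≤ D * (1 + 1 / (m : ℝ)) ^ st.found.card

namespace AdInv

variable {m : ℕ} {I : WSInstance m} {S : Finset (Fin m)}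

theorem init (hm : 0 < m) (I : WSInstance m) (S : Finset (Fin m)) :
    AdInv I S 0 ((adSch m).run I 0) (AdState.init m) (List.finRange m) 1 0 := by
  have hch : charge I S ∅ = 0 := by simp [charge]
  refine ⟨rfl, by simp [Strategy.run], by simp [AdState.queue, AdState.init],
    by simp [AdState.init, hm], List.nodup_finRange m, by simp [Strategy.run],
    by simp [Strategy.run], by simp [AdState.init], by simp [Strategy.run], le_rfl, le_rfl, ?_, ?_,
    by simp [Strategy.run]⟩
  · simp only [Strategy.run, TotalBound, hch]
    have := (growth_pos (List.length (List.finRange m) - 1 + (∅ \ S : Finset (Fin m)).card)).le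
    positivity
  · intro j hj
    have h1 := one_le_growth (List.length (List.finRange m) - 1)
    have h2 := (growth_pos (List.length (List.finRange m) - 1 + (∅ \ S : Finset (Fin m)).card)).le
    -- Nothing has been explored yet, but no target is nearer than 1, so every ray counts as
    -- explored to depth 1.
    refine ⟨1, ⟨le_rfl, le_rfl, ?_, ?_⟩, by simpa using I.one_le_d _⟩
    · rw [one_mul]; exact one_le_pow₀ h1
    · simp only [Strategy.run, hch]
      positivity

variable {n : ℕ} {st : SearchState m} {a : AdState m} {Q T : List (Fin m)} {D h : ℝ} {i : Fin m}

theorem exists_missing (hS : S ∈ I.feasibleSets) {F : Finset (Fin m)}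
    (hW : ¬ I.W ≤ I.weight F) : ∃ i ∈ S, i ∉ F := by
  by_contra hc
  push Not at hc
  exact hW (((I.mem_feasibleSets.1 hS).2).trans (I.weight_mono hc))

theorem next_eq (H : AdInv I S n st a (i :: T) D h) : a.next = some (i, a.D * a.base) := by
  have hr : a.r < a.rays.length := by
    rw [a.length_rays_eq, H.queue_eq]; exact H.index_lt (by simp)
  simp [AdState.next, AdState.getElem?_of_queue hr H.queue_eq]

theorem sub_f (H : AdInv I S n st a (i :: T) D h) : m - a.f = T.length := by
  have := H.len
  rw [H.f_eq]
  simp at this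
  omega

theorem length_rays (H : AdInv I S n st a Q D h) : a.rays.length = m + 1 - a.f := by
  have := H.len
  rw [a.length_rays_eq, H.queue_eq, H.f_eq]
  omega

theorem reach_eq {M : ℕ} (H : AdInv I S n st a (i :: T) D h) (hT : T.length = M + 1) :
    a.D * a.base = ENNReal.ofReal (D * growth (M + 1)) := by
  rw [H.depth_eq, AdState.base_eq (H.sub_f.trans hT),
    ENNReal.ofReal_mul (by linarith [H.one_le_depth])]

theorem depth_le (H : AdInv I S n st a (i :: T) D h) (hi : I.d i ≠ ⊤) :
    D ≤ Real.exp 1 * I.dist i := by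
  obtain ⟨x, hx, hxd⟩ := H.ray 0 (by simp)
  have h1 := I.le_dist hi hxd
  have h2 := hx.depth_le
  have h3 := growth_pow_self_le ((i :: T).length - 1)
  have h4 := hx.one_le
  rw [Nat.sub_zero] at h2
  have h5 : x * growth ((i :: T).length - 1) ^ ((i :: T).length - 1) ≤ I.dist i * Real.exp 1 :=
    mul_le_mul h1 h3 (pow_pos (growth_pos _) _).le (I.dist_nonneg i)
  linarith

theorem ratio_nonneg (m : ℕ) : (0 : ℝ) ≤ 1 + 1 / (m : ℝ) := by positivity

theorem found_step (H : AdInv I S n st a (i :: T) D h) (hi : I.d i ≠ ⊤)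
    (hreach : I.d i ≤ a.D * a.base) (hT : T ≠ []) {st' : SearchState m}
    (hf : st'.found = insert i st.found) (hh : st'.home = st.home + 2 * I.d i)
    (p : ℝ≥0∞ × ℝ≥0) :
    AdInv I S (n + 1) st' (a.update (some p)) T D (h + I.dist i) := by
  have hif : i ∉ st.found := (H.mem_iff i).1 (by simp)
  have hnd := List.nodup_cons.1 H.nodup
  have hD := H.one_le_depth
  obtain ⟨M, hM⟩ : ∃ M, T.length = M + 1 :=
    ⟨T.length - 1, by have := List.length_pos_of_ne_nil hT; omega⟩
  have hde := H.depth_le hi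
  have hdr : I.dist i ≤ D * growth (M + 1) := by
    rw [H.reach_eq hM] at hreach
    have h0 : 0 ≤ D * growth (M + 1) := mul_nonneg (by linarith) (growth_pos _).le
    exact ENNReal.toReal_le_of_le_ofReal h0 hreach
  have hr : a.r < a.rays.length := by
    rw [a.length_rays_eq, H.queue_eq]; exact H.index_lt (by simp)
  have hlen := H.length_rays
  have hlen2 := H.len
  have htot := H.total
  have hray := H.ray
  rw [List.length_cons] at hlen2
  have hf_eq := H.f_eq
  simp only [List.length_cons, Nat.add_sub_cancel, hM] at htot hray
  have hbd : TotalBound M (st'.found \ S).card D (h + I.dist i) (charge I S st'.found) ∧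
      ∀ j x, j ≤ M → RayBound (M + 1) (st.found \ S).card D h (charge I S st.found) (j + 1) x →
        RayBound M (st'.found \ S).card D (h + I.dist i) (charge I S st'.found) j x := by
    by_cases hiS : i ∈ S
    · have e1 : st'.found \ S = st.found \ S := by rw [hf, Finset.insert_sdiff_of_mem _ hiS]
      have e2 : charge I S st'.found = charge I S st.found + (1 + Real.exp 1) * I.dist i := by
        unfold charge
        rw [hf, Finset.insert_inter_of_mem hiS, Finset.sum_insert (by simp [hif])]; ring
      rw [e1, e2]
      exact ⟨htot.relevant (by linarith) hde, fun j x hj hx => hx.relevant hj hde⟩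
    · have e1 : (st'.found \ S).card = (st.found \ S).card + 1 := by
        rw [hf, Finset.insert_sdiff_of_notMem _ hiS, Finset.card_insert_of_notMem (by simp [hif])]
      have e2 : charge I S st'.found = charge I S st.found := by
        unfold charge; rw [hf, Finset.insert_inter_of_notMem hiS]
      rw [e1, e2]
      exact ⟨htot.irrelevant (by linarith) hdr, fun j x hj hx => hx.irrelevant hj hdr⟩
  refine ⟨?_, ?_, AdState.queue_update_some hlen hr H.queue_eq p, ?_, hnd.2, ?_, ?_, H.depth_eq, ?_,
    hD, ?_, ?_, ?_, ?_⟩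
  · simp only [AdState.update]
    rw [H.f_eq, hf, Finset.card_insert_of_notMem hif]
  · rw [hf, Finset.card_insert_of_notMem hif]; omega
  · intro _
    simp only [AdState.update]
    have e : m + 1 - (a.f + 1) = T.length := by omega
    rw [e]
    exact Nat.mod_lt _ (by omega)
  · intro k
    have := H.mem_iff k
    rw [hf]
    simp only [List.mem_cons, Finset.mem_insert, not_or] at this ⊢
    rw [← this]
    constructor
    · intro hk
      exact ⟨fun hki => hnd.1 (hki ▸ hk), Or.inr hk⟩
    · rintro ⟨h1, h2⟩
      exact h2.resolve_left h1
  · rw [hf]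
    exact Finset.insert_subset (I.mem_targets.2 hi) H.found_sub
  · rw [hh, H.home_eq, ← I.ofReal_dist hi, ← ENNReal.ofReal_ofNat,
      ← ENNReal.ofReal_mul (by norm_num), ← ENNReal.ofReal_add]
    · congr 1; ring
    · linarith [H.half_nonneg]
    · linarith [I.dist_nonneg i]
  · linarith [H.half_nonneg, I.dist_nonneg i]
  · rw [hM]; exact hbd.1
  · intro j hj
    obtain ⟨x, hx, hxd⟩ := hray (j + 1) (by omega)
    refine ⟨x, ?_, by simpa using hxd⟩
    rw [hM]
    exact hbd.2 j x (by omega) hx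
  · rw [hf, Finset.card_insert_of_notMem hif, pow_succ, pow_succ, ← mul_assoc]
    exact mul_le_mul_of_nonneg_right H.growth_le (ratio_nonneg m)

theorem fail_step (H : AdInv I S n st a (i :: T) D h)
    (hreach : a.D * a.base < I.d i) (hT : T ≠ []) {st' : SearchState m}
    (hf : st'.found = st.found) (hh : st'.home = st.home + 2 * (a.D * a.base)) :
    ∃ D' h', AdInv I S (n + 1) st' (a.update none) (T ++ [i]) D' h' := by
  have hnd := List.nodup_cons.1 H.nodup
  have hD := H.one_le_depth
  obtain ⟨M, hM⟩ : ∃ M, T.length = M + 1 :=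
    ⟨T.length - 1, by have := List.length_pos_of_ne_nil hT; omega⟩
  have hlen := H.length_rays
  have hlen2 := H.len
  have htot := H.total
  have hray := H.ray
  rw [List.length_cons] at hlen2
  have hf_eq := H.f_eq
  simp only [List.length_cons, Nat.add_sub_cancel, hM] at htot hray
  have hpos : 0 ≤ D * growth (M + 1) := mul_nonneg (by linarith) (growth_pos _).le
  have hD' : 1 ≤ D * growth (M + 1) := by nlinarith [one_le_growth (M + 1)]
  have htot' := htot.fail (by linarith)
  rw [H.reach_eq hM] at hreach hh
  refine ⟨D * growth (M + 1), h + D * growth (M + 1), ?_, ?_, AdState.queue_update_none hlen H.queue_eq,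
    ?_, ?_, ?_, ?_, ?_, ?_, hD', ?_, ?_, ?_, ?_⟩
  · simp only [AdState.update]
    rw [H.f_eq, hf]
  · rw [hf]; simp; omega
  · intro _
    simp only [AdState.update, List.length_append, List.length_singleton]
    have e : m + 1 - a.f = T.length + 1 := by omega
    rw [e]
    exact Nat.mod_lt _ (by omega)
  · rw [List.nodup_append_comm]; simpa using H.nodup
  · intro k
    have := H.mem_iff k
    rw [hf, ← this]
    simp [or_comm]
  · rw [hf]; exact H.found_sub
  · exact H.reach_eq hM
  · rw [hh, H.home_eq, ← ENNReal.ofReal_ofNat, ← ENNReal.ofReal_mul (by norm_num),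
      ← ENNReal.ofReal_add]
    · congr 1; ring
    · linarith [H.half_nonneg]
    · linarith
  · linarith [H.half_nonneg]
  · simpa [hf, hM] using htot'
  · intro j hj
    simp only [List.length_append, List.length_singleton] at hj
    simp only [List.length_append, List.length_singleton, Nat.add_sub_cancel, hM, hf]
    rcases Nat.lt_or_ge j T.length with hjT | hjT
    · obtain ⟨x, hx, hxd⟩ := hray (j + 1) (by omega)
      refine ⟨x, hx.fail (by omega), ?_⟩
      rw [List.getElem_append_left hjT]
      simpa using hxd
    · have hjM : j = M + 1 := by omega
      subst hjM
      refine ⟨D * growth (M + 1), htot'.rayBound hD', ?_⟩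
      rw [List.getElem_append_right (by omega)]
      simpa using hreach.le
  · rw [hf, pow_succ]
    have h1 : 1 + 1 / (m : ℝ) ≤ growth (M + 1) := by
      exact growth_anti (n := m) (by omega) (by omega)
    have h2 := mul_le_mul H.growth_le h1 (ratio_nonneg m)
      (mul_nonneg (by linarith) (pow_nonneg (ratio_nonneg m) _))
    linarith

end AdInv

namespace AdInv

variable {m : ℕ} {I : WSInstance m} {S : Finset (Fin m)}
variable {n : ℕ} {st : SearchState m} {a : AdState m} {Q T : List (Fin m)} {D h : ℝ} {i : Fin m}

/-- The variables of the adaptive strategy after the explorations of a history. -/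
abbrev vars (l : List (Probe m)) : AdState m :=
  l.foldl (fun a p => a.update p.result) (AdState.init m)

theorem step_eq (H : AdInv I S n st (vars st.hist) (i :: T) D h) :
    (adSch m).step I st =
      if I.d i ≠ ⊤ ∧ I.d i ≤ (vars st.hist).D * (vars st.hist).base then
        { hist := st.hist ++ [⟨i, (vars st.hist).D * (vars st.hist).base, some (I.d i, I.w i)⟩]
          found := insert i st.found
          turn := st.home + I.d i
          home := st.home + 2 * I.d i }
      else
        { hist := st.hist ++ [⟨i, (vars st.hist).D * (vars st.hist).base, none⟩]
          found := st.found
          turn := st.home + (vars st.hist).D * (vars st.hist).base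
          home := st.home + 2 * ((vars st.hist).D * (vars st.hist).base) } := by
  have h1 : adSch m I.W st.hist = some (i, (vars st.hist).D * (vars st.hist).base) := H.next_eq
  have h2 : i ∉ st.found := (H.mem_iff i).1 (by simp)
  simp only [Strategy.step, h1, h2, if_false]

theorem exists_cons (H : AdInv I S n st a Q D h) {k : Fin m} (hk : k ∉ st.found) :
    ∃ i T, Q = i :: T := by
  have := (H.mem_iff k).2 hk
  cases Q with
  | nil => simp at this
  | cons i T => exact ⟨i, T, rfl⟩

theorem succ (H : AdInv I S n st (vars st.hist) Q D h) (hS : S ∈ I.feasibleSets)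
    (hW : ¬ I.W ≤ I.weight ((adSch m).step I st).found) :
    ∃ Q' D' h', AdInv I S (n + 1) ((adSch m).step I st) (vars ((adSch m).step I st).hist)
      Q' D' h' := by
  obtain ⟨k, hkS, hk⟩ := exists_missing hS hW
  have hkt := I.mem_targets.1 ((I.mem_feasibleSets.1 hS).1 hkS)
  obtain ⟨i, T, rfl⟩ : ∃ i T, Q = i :: T := by
    by_cases hkf : k ∈ st.found
    · cases Q with
      | nil =>
        have hlen := H.len
        have h1 : st.found = Finset.univ := Finset.card_eq_iff_eq_univ _ |>.1 (by simpa using hlen)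
        have h2 : adSch m I.W st.hist = none := by
          change (vars st.hist).next = none
          have h3 : (vars st.hist).rays = [] := by
            rw [← List.length_eq_zero_iff, AdState.length_rays_eq, H.queue_eq]; rfl
          simp [AdState.next, h3]
        simp [Strategy.step, h2, h1] at hk
      | cons i T => exact ⟨i, T, rfl⟩
    · exact H.exists_cons hkf
  have hstep := H.step_eq
  have hif : i ∉ st.found := (H.mem_iff i).1 (by simp)
  by_cases hc : I.d i ≠ ⊤ ∧ I.d i ≤ (vars st.hist).D * (vars st.hist).base
  · rw [if_pos hc] at hstep
    -- Had this been the only ray left, every target, including the missing `k`, would now be found.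
    have hT : T ≠ [] := by
      rintro rfl
      rw [hstep] at hk
      have h1 := (H.mem_iff k).2 fun h => hk (Finset.mem_insert_of_mem h)
      rw [List.mem_singleton] at h1
      exact hk (h1 ▸ Finset.mem_insert_self _ _)
    refine ⟨T, D, h + I.dist i, ?_⟩
    have := H.found_step hc.1 hc.2 hT (st' := (adSch m).step I st) (by rw [hstep])
      (by rw [hstep]) (I.d i, I.w i)
    convert this using 1
    rw [hstep]
    simp [vars]
  · rw [if_neg hc] at hstep
    have hki : k ∈ i :: T := (H.mem_iff k).2 (by rwa [hstep] at hk)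
    -- A last remaining ray is searched to infinite depth, so the target `k` on it could not have
    -- been missed.
    have hT : T ≠ [] := by
      rintro rfl
      rw [List.mem_singleton] at hki
      refine hc ⟨hki ▸ hkt, ?_⟩
      rw [AdState.base_eq_top H.sub_f, ENNReal.mul_top]
      · exact le_top
      · rw [H.depth_eq]
        simpa using (by linarith [H.one_le_depth] : 0 < D)
    have hlt : (vars st.hist).D * (vars st.hist).base < I.d i := by
      by_cases h1 : I.d i = ⊤
      · obtain ⟨M, hM⟩ : ∃ M, T.length = M + 1 :=
          ⟨T.length - 1, by have := List.length_pos_of_ne_nil hT; omega⟩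
        rw [h1, H.reach_eq hM]
        exact ENNReal.ofReal_lt_top
      · by_contra h2
        exact hc ⟨h1, not_lt.1 h2⟩
    obtain ⟨D', h', this⟩ := H.fail_step hlt hT (st' := (adSch m).step I st) (by rw [hstep])
      (by rw [hstep])
    refine ⟨T ++ [i], D', h', ?_⟩
    convert this using 1
    rw [hstep]
    simp [vars]

theorem exists_run (hm : 0 < m) (hS : S ∈ I.feasibleSets) (n : ℕ)
    (hn : ∀ k ≤ n, ¬ I.W ≤ I.weight ((adSch m).run I k).found) :
    ∃ Q D h, AdInv I S n ((adSch m).run I n) (vars ((adSch m).run I n).hist) Q D h := by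
  induction n with
  | zero => exact ⟨_, _, _, init hm I S⟩
  | succ n ih =>
    obtain ⟨Q, D, h, H⟩ := ih fun k hk => hn k (by omega)
    exact H.succ hS (hn (n + 1) le_rfl)

theorem ray_of_mem (H : AdInv I S n st a Q D h) {k : Fin m} (hk : k ∉ st.found)
    (hd : I.d k ≠ ⊤) : ∃ (j : ℕ) (hj : j < Q.length) (x : ℝ), Q[j] = k ∧ x ≤ I.dist k ∧
      RayBound (Q.length - 1) (st.found \ S).card D h (charge I S st.found) j x := by
  obtain ⟨j, hj, rfl⟩ := List.getElem_of_mem ((H.mem_iff k).2 hk)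
  obtain ⟨x, hx, hxd⟩ := H.ray j hj
  exact ⟨j, hj, x, rfl, I.le_dist hd hxd, hx⟩

/-- A missing relevant target keeps `D` below `e` times its distance, whereas `growth_le` makes `D`
unbounded. -/
theorem exists_finished (hm : 0 < m) (hS : S ∈ I.feasibleSets) :
    ∃ n, I.W ≤ I.weight ((adSch m).run I n).found := by
  by_contra hc
  push Not at hc
  have hm' : (0 : ℝ) < m := by exact_mod_cast hm
  have hq : (1 : ℝ) < 1 + 1 / (m : ℝ) := by
    have : (0 : ℝ) < 1 / (m : ℝ) := by positivity
    linarith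
  obtain ⟨n, hn⟩ := pow_unbounded_of_one_lt
    ((∑ k ∈ S, I.dist k) * Real.exp 1 * (1 + 1 / (m : ℝ)) ^ m) hq
  obtain ⟨Q, D, h, H⟩ := exists_run hm hS n fun k _ => not_le.2 (hc k)
  obtain ⟨k, hkS, hk⟩ := exists_missing hS (not_le.2 (hc n))
  obtain ⟨j, hj, x, -, hxd, hx⟩ :=
    H.ray_of_mem hk (I.mem_targets.1 ((I.mem_feasibleSets.1 hS).1 hkS))
  have h1 : growth (Q.length - 1) ^ (Q.length - 1 - j) ≤ Real.exp 1 :=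
    (pow_le_pow_right₀ (one_le_growth _) (Nat.sub_le _ _)).trans (growth_pow_self_le _)
  have h2 : x ≤ ∑ k ∈ S, I.dist k :=
    hxd.trans (Finset.single_le_sum (f := I.dist) (fun _ _ => I.dist_nonneg _) hkS)
  have h3 : D ≤ (∑ k ∈ S, I.dist k) * Real.exp 1 :=
    hx.depth_le.trans (mul_le_mul h2 h1 (pow_pos (growth_pos _) _).le (by linarith [hx.one_le]))
  have h4 : (1 + 1 / (m : ℝ)) ^ ((adSch m).run I n).found.card ≤ (1 + 1 / (m : ℝ)) ^ m :=
    pow_le_pow_right₀ hq.le (by have := H.len; omega)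
  have h5 := mul_le_mul h3 h4 (by positivity) (by linarith [H.one_le_depth])
  linarith [H.growth_le]

/-- Here `s` sums the relevant distances already found and `U` those of the `v + 1` missing ones,
the smallest being `y`. The last one-way distance `t` counts separately only if the last target is
relevant; then the `-1` in `hX` pays for `y` and the rest of `t` is part of `U`. -/
theorem final_bound {B X U s t y : ℝ} {v : ℕ} (hB : 2 * (1 + Real.exp 1) ≤ B)
    (hX : X ≤ B * (v + 1) - 1) (hy : 0 ≤ y) (hs : 0 ≤ s)
    (hU : (v + 1) * y ≤ U) (hUt : t = 0 ∨ (y ≤ t ∧ t + v * y ≤ U)) :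
    t + X * y + 2 * ((1 + Real.exp 1) * s) ≤ B * (s + U) := by
  have he := Real.exp_pos 1
  have h1 : 2 * ((1 + Real.exp 1) * s) ≤ B * s := by
    rw [← mul_assoc]; gcongr
  have h2 := mul_le_mul_of_nonneg_right hX hy
  rcases hUt with rfl | ⟨h3, h4⟩
  · have := mul_le_mul_of_nonneg_left hU (by linarith : 0 ≤ B)
    nlinarith
  · have := mul_le_mul_of_nonneg_left h4 (by linarith : 0 ≤ B)
    nlinarith

theorem turn_le (H : AdInv I S n st (vars st.hist) Q D h) (hS : S ∈ I.feasibleSets)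
    (hW : ¬ I.W ≤ I.weight st.found) (hW' : I.W ≤ I.weight ((adSch m).step I st).found) :
    ((adSch m).step I st).turn ≤
      ENNReal.ofReal (ratioBound (m - S.card) * ∑ k ∈ S, I.dist k) := by
  have hSt : ∀ k ∈ S, I.d k ≠ ⊤ := fun k hk =>
    I.mem_targets.1 ((I.mem_feasibleSets.1 hS).1 hk)
  obtain ⟨k₀, hk₀S, hk₀⟩ := exists_missing hS hW
  obtain ⟨i, T, rfl⟩ := H.exists_cons hk₀
  have hif : i ∉ st.found := (H.mem_iff i).1 (by simp)
  have hstep := H.step_eq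
  by_cases hc : I.d i ≠ ⊤ ∧ I.d i ≤ (vars st.hist).D * (vars st.hist).base
  swap
  · rw [hstep, if_neg hc] at hW'
    exact absurd hW' hW
  rw [hstep, if_pos hc]
  -- The ray bound is evaluated at the nearest missing relevant target.
  obtain ⟨k, hk, hmin⟩ := Finset.exists_min_image (S \ st.found) I.dist
    ⟨k₀, Finset.mem_sdiff.2 ⟨hk₀S, hk₀⟩⟩
  obtain ⟨hkS, hkf⟩ := Finset.mem_sdiff.1 hk
  obtain ⟨j, hj, x, hjk, hxd, hx⟩ := H.ray_of_mem hkf (hSt k hkS)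
  have hlen := H.len
  simp only [List.length_cons] at hlen hj
  simp only [List.length_cons, Nat.add_sub_cancel] at hx
  set g := (st.found \ S).card with hg
  set y := I.dist k with hy
  obtain ⟨v, hv⟩ : ∃ v, (S \ st.found).card = v + 1 :=
    ⟨(S \ st.found).card - 1, by have := Finset.card_pos.2 ⟨k, hk⟩; omega⟩
  have hcard : T.length + g = m - S.card + v := by
    have h1 := Finset.card_sdiff_add_card_inter st.found S
    have h2 := Finset.card_sdiff_add_card_inter S st.found
    rw [Finset.inter_comm] at h2
    have h3 : S.card ≤ m := by simpa using Finset.card_le_univ S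
    omega
  have hsum : ∑ k ∈ S, I.dist k =
      ∑ k ∈ st.found ∩ S, I.dist k + ∑ k ∈ S \ st.found, I.dist k := by
    rw [Finset.inter_comm, Finset.sum_inter_add_sum_sdiff]
  have hU : ((v : ℝ) + 1) * y ≤ ∑ k ∈ S \ st.found, I.dist k := by
    have := Finset.card_nsmul_le_sum _ I.dist y hmin
    rw [hv] at this
    simpa using this
  have hpow : ∀ e ≤ T.length + g, ∀ z : ℝ, z ≤ y →
      ((T.length + g : ℕ) + 1) * z * growth (T.length + g) ^ e ≤
        ((T.length + g : ℕ) + 1) * y * growth (T.length + g) ^ (T.length + g) := by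
    intro e he z hz
    have h1 := pow_le_pow_right₀ (one_le_growth (T.length + g)) he
    have h2 := (pow_pos (growth_pos (T.length + g)) e).le
    have h3 : 0 ≤ y := I.dist_nonneg k
    gcongr
  have hnum := le_ratioBound_mul (m - S.card) v
  have hB := le_ratioBound (m - S.card)
  rw [← hcard] at hnum
  have e1 : 2 * (((m - S.card : ℕ) : ℝ) + v + 1) = 2 * (((T.length + g : ℕ) : ℝ) + 1) := by
    rw [hcard]; push_cast; ring
  rw [e1] at hnum
  have hch : charge I S st.found = (1 + Real.exp 1) * ∑ k ∈ st.found ∩ S, I.dist k := rfl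
  have hs : 0 ≤ ∑ k ∈ st.found ∩ S, I.dist k := Finset.sum_nonneg fun _ _ => I.dist_nonneg _
  rw [H.home_eq, ← I.ofReal_dist hc.1, ← ENNReal.ofReal_add (by linarith [H.half_nonneg])
    (I.dist_nonneg i)]
  refine ENNReal.ofReal_le_ofReal ?_
  rw [hsum]
  by_cases hiS : i ∈ S
  · have hcost := hx.cost_le.trans (add_le_add_left (hpow _ (Nat.sub_le _ _) x hxd) _)
    have hiU : i ∈ S \ st.found := Finset.mem_sdiff.2 ⟨hiS, hif⟩
    have hUt : I.dist i + v * y ≤ ∑ k ∈ S \ st.found, I.dist k := by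
      rw [← Finset.add_sum_erase _ _ hiU]
      have := Finset.card_nsmul_le_sum ((S \ st.found).erase i) I.dist y
        fun l hl => hmin l (Finset.mem_of_mem_erase hl)
      rw [Finset.card_erase_of_mem hiU, hv] at this
      simpa using this
    have := final_bound hB hnum (I.dist_nonneg k) hs hU (Or.inr ⟨hmin i hiU, hUt⟩)
    rw [hch] at hcost
    linarith
  -- The head `i` of the queue is irrelevant, so `k` is further back and advances by one position.
  -- This pays for `I.dist i` as well, and no separate final walk remains.
  · obtain ⟨j, rfl⟩ : ∃ j', j = j' + 1 := by
      cases j with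
      | zero =>
        have hik : i = k := hjk
        exact absurd (hik ▸ hkS) hiS
      | succ j => exact ⟨j, rfl⟩
    obtain ⟨M, hM⟩ : ∃ M, T.length = M + 1 := ⟨T.length - 1, by omega⟩
    have hdr : I.dist i ≤ D * growth (M + 1) := by
      have hreach := hc.2
      rw [H.reach_eq hM] at hreach
      have h0 : 0 ≤ D * growth (M + 1) :=
        mul_nonneg (by linarith [H.one_le_depth]) (growth_pos _).le
      exact ENNReal.toReal_le_of_le_ofReal h0 hreach
    rw [hM] at hx
    have hcost := hx.step_cost (by omega) hdr
    rw [← hM] at hcost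
    have hcost := hcost.trans (add_le_add_left (hpow _ (Nat.sub_le _ _) x hxd) _)
    have := final_bound hB hnum (I.dist_nonneg k) hs hU (Or.inl rfl)
    rw [hch] at hcost
    linarith [I.dist_nonneg i]

end AdInv

/-- Nothing about optimality is needed: the comparison is with the sum of the distances in any
feasible `S`, which is at most `d_S`. -/
theorem cost_adSch_le {m : ℕ} {I : WSInstance m} {S : Finset (Fin m)} (hS : S ∈ I.feasibleSets) :
    (adSch m).cost I ≤ ENNReal.ofReal (ratioBound (m - S.card)) * I.setCost S := by
  classical
  by_cases hW0 : I.W ≤ I.weight ((adSch m).run I 0).found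
  · have hex : ∃ n, I.W ≤ I.weight ((adSch m).run I n).found := ⟨0, hW0⟩
    have h0 : Nat.find hex = 0 := (Nat.find_eq_zero hex).2 hW0
    rw [Strategy.cost, dif_pos hex, h0]
    exact zero_le
  · have hm : 0 < m := by
      rcases Nat.eq_zero_or_pos m with rfl | hm
      · refine absurd (I.feasible.trans ?_) hW0
        simp
      · exact hm
    have hex := AdInv.exists_finished hm hS
    rw [Strategy.cost, dif_pos hex]
    obtain ⟨n, hn⟩ : ∃ n, Nat.find hex = n + 1 := by
      refine ⟨Nat.find hex - 1, ?_⟩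
      have : Nat.find hex ≠ 0 := fun h => hW0 ((Nat.find_eq_zero hex).1 h)
      omega
    have hspec := Nat.find_spec hex
    have hlt : ∀ k ≤ n, ¬ I.W ≤ I.weight ((adSch m).run I k).found := fun k hk =>
      Nat.find_min hex (by omega)
    rw [hn] at hspec ⊢
    obtain ⟨Q, D, h, H⟩ := AdInv.exists_run hm hS n hlt
    refine (H.turn_le hS (hlt n le_rfl) hspec).trans ?_
    have hB : 0 ≤ ratioBound (m - S.card) := by
      linarith [le_ratioBound (m - S.card), Real.exp_pos 1]
    rw [ENNReal.ofReal_mul hB, ENNReal.ofReal_sum_of_nonneg fun _ _ => I.dist_nonneg _]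
    gcongr
    refine le_trans (le_of_eq ?_) (I.sum_le_setCost (I.mem_feasibleSets.1 hS).1)
    exact Finset.sum_congr rfl fun k hk =>
      I.ofReal_dist (I.mem_targets.1 ((I.mem_feasibleSets.1 hS).1 hk))

theorem phi_eq_ratioBound {n : ℕ} (hn : n ≠ 0) : phi n = ratioBound n := by
  rw [phi, ratioBound, if_neg hn, Real.rpow_natCast, growth]
  ring

theorem cost_adSch_le_opt {m : ℕ} (I : WSInstance m) :
    (I.optCard < m →
      (adSch m).cost I ≤ ENNReal.ofReal (phi ((m : ℝ) - (I.optCard : ℝ))) * I.opt) ∧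
    (¬ I.optCard < m →
      (adSch m).cost I ≤ ENNReal.ofReal (3 + 2 * Real.exp 1) * I.opt) := by
  obtain ⟨S, hS, hopt, hcard⟩ := I.exists_optimal
  have h := cost_adSch_le hS
  rw [hopt, hcard] at h
  refine ⟨fun hlt => ?_, fun hlt => ?_⟩
  · rwa [← Nat.cast_sub hlt.le, phi_eq_ratioBound (by omega)]
  · rwa [show m - I.optCard = 0 by omega, ratioBound, if_pos rfl] at h

/-! ### Instances in which every target is needed -/

namespace WSInstance

variable {m : ℕ} (I : WSInstance m)

/-- All targets are needed. -/
structure Tight : Prop where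
  W_eq : I.W = I.targets.card
  w_eq : ∀ i, I.w i = 1

variable {I}

theorem Tight.weight_eq (h : I.Tight) (S : Finset (Fin m)) : I.weight S = S.card := by
  simp [weight, h.w_eq]

theorem Tight.le_weight_iff (h : I.Tight) {S : Finset (Fin m)} (hS : S ⊆ I.targets) :
    I.W ≤ I.weight S ↔ S = I.targets := by
  rw [h.weight_eq, h.W_eq, Nat.cast_le]
  exact ⟨fun hc => Finset.eq_of_subset_of_card_le hS hc, fun hc => hc ▸ le_rfl⟩

theorem Tight.feasibleSets_eq (h : I.Tight) : I.feasibleSets = {I.targets} := by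
  ext S
  rw [mem_feasibleSets, Finset.mem_singleton]
  constructor
  · rintro ⟨h1, h2⟩; exact (h.le_weight_iff h1).1 h2
  · rintro rfl; exact ⟨subset_rfl, I.feasible⟩

theorem Tight.opt_eq (h : I.Tight) : I.opt = I.setCost I.targets := by
  simp [opt, h.feasibleSets_eq]

theorem Tight.optCard_eq (h : I.Tight) : I.optCard = I.targets.card := by
  have h1 := h.opt_eq
  rw [optCard, h.feasibleSets_eq, Finset.filter_singleton, if_pos h1.symm, Finset.sup_singleton]

theorem setCost_le {S : Finset (Fin m)} {i : Fin m} (hi : i ∈ S) :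
    I.setCost S ≤ 2 * ∑ k ∈ S.erase i, I.d k + I.d i := by
  rw [setCost, ← Finset.add_sum_erase _ _ hi, tsub_le_iff_right, mul_add, two_mul (I.d i)]
  have := Finset.le_sup (f := I.d) hi
  calc I.d i + I.d i + 2 * ∑ k ∈ S.erase i, I.d k
      = 2 * ∑ k ∈ S.erase i, I.d k + I.d i + I.d i := by ring
    _ ≤ _ := by gcongr

/-- The instance with the given finite or infinite distances in which all targets are needed. -/
def tight (d : Fin m → ℝ≥0∞) (hd : ∀ i, 1 ≤ d i) : WSInstance m where
  W := ({i | d i ≠ ⊤} : Finset (Fin m)).card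
  d := d
  w := fun _ => 1
  one_le_d := hd
  feasible := by simp

theorem tight_tight (d : Fin m → ℝ≥0∞) (hd : ∀ i, 1 ≤ d i) : (tight d hd).Tight :=
  ⟨rfl, fun _ => rfl⟩

end WSInstance

/-! ### Comparing runs of a strategy on different placements of targets -/

namespace Strategy

variable {m : ℕ} (Sg : Strategy m)

/-- One exploration, for targets that need not reach the weight objective. -/
def rawStep (W : ℝ≥0) (d : Fin m → ℝ≥0∞) (w : Fin m → ℝ≥0) (st : SearchState m) :
    SearchState m :=
  match Sg W st.hist with
  | none => st
  | some (r, l) =>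
    if r ∈ st.found then
      { st with hist := st.hist ++ [⟨r, l, none⟩] }
    else if d r ≠ ⊤ ∧ d r ≤ l then
      { hist := st.hist ++ [⟨r, l, some (d r, w r)⟩]
        found := insert r st.found
        turn := st.home + d r
        home := st.home + 2 * d r }
    else
      { hist := st.hist ++ [⟨r, l, none⟩]
        found := st.found
        turn := st.home + l
        home := st.home + 2 * l }

/-- The situation after `n` explorations, for targets that need not reach the weight objective. -/
def rawRun (W : ℝ≥0) (d : Fin m → ℝ≥0∞) (w : Fin m → ℝ≥0) : ℕ → SearchState m
  | 0 => { hist := [], found := ∅, turn := 0, home := 0 }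
  | n + 1 => Sg.rawStep W d w (rawRun W d w n)

theorem run_eq_rawRun (I : WSInstance m) (n : ℕ) : Sg.run I n = Sg.rawRun I.W I.d I.w n := by
  induction n with
  | zero => rfl
  | succ n ih => rw [run, rawRun, ← ih]; rfl

variable {W : ℝ≥0} {d d' : Fin m → ℝ≥0∞} {w : Fin m → ℝ≥0}

/-- The three possible effects of an exploration. -/
theorem rawStep_cases (W : ℝ≥0) (d : Fin m → ℝ≥0∞) (w : Fin m → ℝ≥0) (st : SearchState m) :
    ((Sg.rawStep W d w st).found = st.found ∧ st.home ≤ (Sg.rawStep W d w st).home) ∨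
    ∃ r l, Sg W st.hist = some (r, l) ∧ r ∉ st.found ∧ d r ≠ ⊤ ∧ d r ≤ l ∧
      (Sg.rawStep W d w st).found = insert r st.found ∧
      (Sg.rawStep W d w st).turn = st.home + d r ∧
      (Sg.rawStep W d w st).home = st.home + 2 * d r := by
  unfold rawStep
  split
  · simp
  · rename_i r l heq
    split_ifs with h1 h2
    · simp
    · exact Or.inr ⟨r, l, heq, h1, h2.1, h2.2, rfl, rfl, rfl⟩
    · simp

theorem found_mono : Monotone fun n => (Sg.rawRun W d w n).found := by
  refine monotone_nat_of_le_succ fun n => ?_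
  rcases Sg.rawStep_cases W d w (Sg.rawRun W d w n) with h | ⟨r, l, -, -, -, -, h, -⟩
  · exact h.1.symm.le
  · simp only [rawRun, h]
    exact Finset.subset_insert _ _

theorem found_finite (n : ℕ) : ∀ i ∈ (Sg.rawRun W d w n).found, d i ≠ ⊤ := by
  induction n with
  | zero => simp [rawRun]
  | succ n ih =>
    rw [rawRun]
    rcases Sg.rawStep_cases W d w (Sg.rawRun W d w n) with h | ⟨r, l, -, -, hr, -, h, -⟩
    · rwa [h.1]
    · rw [h]
      intro i hi
      rcases Finset.mem_insert.1 hi with rfl | hi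
      · exact hr
      · exact ih i hi

theorem home_add_le {n k : ℕ} (hnk : n ≤ k) (hn : (Sg.rawRun W d w n).found = ∅) :
    (Sg.rawRun W d w n).home + 2 * ∑ i ∈ (Sg.rawRun W d w k).found, d i ≤
      (Sg.rawRun W d w k).home := by
  induction k, hnk using Nat.le_induction with
  | base => simp [hn]
  | succ k hnk ih =>
    rw [show Sg.rawRun W d w (k + 1) = Sg.rawStep W d w (Sg.rawRun W d w k) from rfl]
    rcases Sg.rawStep_cases W d w (Sg.rawRun W d w k) with h | ⟨r, l, -, hr, -, -, h, -, hh⟩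
    · rw [h.1]; exact ih.trans h.2
    · rw [h, hh, Finset.sum_insert hr, mul_add, ← add_assoc, add_right_comm]
      gcongr

theorem home_mono : Monotone fun n => (Sg.rawRun W d w n).home := by
  refine monotone_nat_of_le_succ fun n => ?_
  rcases Sg.rawStep_cases W d w (Sg.rawRun W d w n) with h | ⟨r, l, -, -, -, -, -, -, h⟩
  · exact h.2
  · simp only [rawRun, h]
    exact le_self_add

/-- Hiding targets that have not been found yet does not change the search. -/
theorem rawRun_congr (h : ∀ i, d' i = ⊤ ∨ d' i = d i) {n : ℕ}
    (hn : ∀ i ∈ (Sg.rawRun W d w n).found, d' i = d i) :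
    Sg.rawRun W d w n = Sg.rawRun W d' w n := by
  induction n with
  | zero => rfl
  | succ n ih =>
    have h1 := ih fun i hi => hn i (Sg.found_mono (Nat.le_succ n) hi)
    rw [rawRun] at hn
    rw [rawRun, rawRun, ← h1]
    generalize Sg.rawRun W d w n = st at *
    unfold rawStep at hn ⊢
    cases hs : Sg W st.hist with
    | none => rfl
    | some p =>
      obtain ⟨r, l⟩ := p
      simp only [hs] at hn ⊢
      split_ifs at hn ⊢ with h2 h3 h4 h4
      · rfl
      · rw [hn r (Finset.mem_insert_self _ _)]
      · exact absurd (by rwa [hn r (Finset.mem_insert_self _ _)]) h4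
      · rcases h r with h5 | h5
        · exact absurd h5 h4.1
        · exact absurd (by rwa [← h5]) h3
      · rfl

/-- If the objective is not reached after `n` explorations, it is reached in a later exploration
which finds a target, or the cost is infinite. -/
theorem cost_cases (I : WSInstance m) {n : ℕ}
    (hn : ¬ I.W ≤ I.weight (Sg.rawRun I.W I.d I.w n).found) :
    Sg.cost I = ⊤ ∨ ∃ k r, n ≤ k ∧ r ∉ (Sg.rawRun I.W I.d I.w k).found ∧
      (Sg.rawRun I.W I.d I.w (k + 1)).found = insert r (Sg.rawRun I.W I.d I.w k).found ∧
      I.W ≤ I.weight (Sg.rawRun I.W I.d I.w (k + 1)).found ∧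
      Sg.cost I = (Sg.rawRun I.W I.d I.w k).home + I.d r := by
  classical
  by_cases hex : ∃ n, I.W ≤ I.weight (Sg.run I n).found
  swap
  · left; rw [cost, dif_neg hex]
  right
  obtain ⟨N, hc, hspec, hmin⟩ : ∃ N, Sg.cost I = (Sg.run I N).turn ∧
      I.W ≤ I.weight (Sg.run I N).found ∧ ∀ k < N, ¬ I.W ≤ I.weight (Sg.run I k).found :=
    ⟨Nat.find hex, by rw [cost, dif_pos hex], Nat.find_spec hex, fun _ => Nat.find_min hex⟩
  simp only [run_eq_rawRun] at hc hspec hmin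
  have hlt : n < N := by
    by_contra hle
    exact hn (hspec.trans (I.weight_mono (Sg.found_mono (not_lt.1 hle))))
  obtain ⟨k, rfl⟩ : ∃ k, N = k + 1 := ⟨N - 1, by omega⟩
  have hk' := hmin k (by omega)
  rcases Sg.rawStep_cases I.W I.d I.w (Sg.rawRun I.W I.d I.w k) with h | ⟨r, l, -, hr, -, -, h, ht, -⟩
  · rw [rawRun, h.1] at hspec
    exact absurd hspec hk'
  · exact ⟨k, r, by omega, hr, h, hspec, hc.trans ht⟩

theorem home_le_cost (I : WSInstance m) {n : ℕ}
    (hn : ¬ I.W ≤ I.weight (Sg.rawRun I.W I.d I.w n).found) :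
    (Sg.rawRun I.W I.d I.w n).home ≤ Sg.cost I := by
  rcases Sg.cost_cases I hn with h | ⟨k, r, hk, -, -, -, h⟩
  · simp [h]
  · rw [h]
    exact (Sg.home_mono hk).trans le_self_add

/-- All targets of the final feasible set are found after exploration `n`, each at twice its
distance except the last, which counts once. This is at least `d_S` for that set `S`. -/
theorem home_add_opt_le_cost (I : WSInstance m) {n : ℕ}
    (hn : ¬ I.W ≤ I.weight (Sg.rawRun I.W I.d I.w n).found)
    (h0 : (Sg.rawRun I.W I.d I.w n).found = ∅) :
    (Sg.rawRun I.W I.d I.w n).home + I.opt ≤ Sg.cost I := by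
  rcases Sg.cost_cases I hn with h | ⟨k, r, hk, hr, hins, hW, h⟩
  · simp [h]
  · have hfeas : (Sg.rawRun I.W I.d I.w (k + 1)).found ∈ I.feasibleSets :=
      I.mem_feasibleSets.2 ⟨fun i hi => I.mem_targets.2 (Sg.found_finite _ i hi), hW⟩
    have hopt : I.opt ≤ I.setCost (Sg.rawRun I.W I.d I.w (k + 1)).found := Finset.inf_le hfeas
    have hle := I.setCost_le (S := (Sg.rawRun I.W I.d I.w (k + 1)).found) (i := r)
      (by rw [hins]; exact Finset.mem_insert_self _ _)
    rw [hins, Finset.erase_insert hr, ← hins] at hle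
    rw [h]
    calc (Sg.rawRun I.W I.d I.w n).home + I.opt
        ≤ (Sg.rawRun I.W I.d I.w n).home +
          (2 * ∑ i ∈ (Sg.rawRun I.W I.d I.w k).found, I.d i + I.d r) := by
            gcongr; exact hopt.trans hle
      _ = (Sg.rawRun I.W I.d I.w n).home +
          2 * ∑ i ∈ (Sg.rawRun I.W I.d I.w k).found, I.d i + I.d r := by rw [add_assoc]
      _ ≤ _ := by gcongr; exact Sg.home_add_le hk h0

end Strategy

namespace Strategy

variable {m : ℕ} (Sg : Strategy m)
variable {W : ℝ≥0} {d d' : Fin m → ℝ≥0∞} {w : Fin m → ℝ≥0}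

/-- The depth prescribed for ray `j` in the exploration number `k` (zero if it is on another ray). -/
def reach (W : ℝ≥0) (d : Fin m → ℝ≥0∞) (w : Fin m → ℝ≥0) (j : Fin m) (k : ℕ) : ℝ≥0∞ :=
  match Sg W (Sg.rawRun W d w k).hist with
  | none => 0
  | some (r, l) => if r = j then l else 0

theorem eq_some_of_reach {j : Fin m} {k : ℕ} (h : Sg.reach W d w j k ≠ 0) :
    Sg W (Sg.rawRun W d w k).hist = some (j, Sg.reach W d w j k) := by
  unfold reach at *
  cases hs : Sg W (Sg.rawRun W d w k).hist with
  | none => simp [hs] at h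
  | some p =>
    obtain ⟨r, l⟩ := p
    by_cases hr : r = j
    · simp [hr]
    · simp [hs, hr] at h

theorem reach_eq_of_some {j : Fin m} {l : ℝ≥0∞} {k : ℕ}
    (h : Sg W (Sg.rawRun W d w k).hist = some (j, l)) : Sg.reach W d w j k = l := by
  simp [reach, h]

theorem sum_reach {F : Finset (Fin m)} {j : Fin m} (hj : j ∈ F) {k : ℕ}
    (h : Sg.reach W d w j k ≠ 0) : ∑ i ∈ F, Sg.reach W d w i k = Sg.reach W d w j k := by
  refine Finset.sum_eq_single j (fun i _ hij => ?_) fun h' => absurd hj h'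
  by_contra hi
  have h1 := Sg.eq_some_of_reach h
  rw [Sg.eq_some_of_reach hi, Option.some.injEq, Prod.mk.injEq] at h1
  exact hij h1.1

/-- A ray without target is walked to the full prescribed depth and back, and one exploration
concerns at most one ray of `F`. -/
theorem home_succ_ge {F : Finset (Fin m)} (hF : ∀ j ∈ F, d j = ⊤) (k : ℕ) :
    (Sg.rawRun W d w k).home + 2 * ∑ j ∈ F, Sg.reach W d w j k ≤
      (Sg.rawRun W d w (k + 1)).home := by
  by_cases h : ∃ j ∈ F, Sg.reach W d w j k ≠ 0
  · obtain ⟨j, hj, h⟩ := h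
    have h1 := Sg.eq_some_of_reach h
    have h2 : j ∉ (Sg.rawRun W d w k).found := fun hc => Sg.found_finite k j hc (hF j hj)
    rw [Sg.sum_reach hj h, rawRun]
    unfold rawStep
    rw [h1]
    simp [h2, hF j hj]
  · push Not at h
    rw [Finset.sum_eq_zero h, mul_zero, add_zero]
    exact Sg.home_mono (Nat.le_succ k)

theorem two_mul_sum_reach_le {F : Finset (Fin m)} (hF : ∀ j ∈ F, d j = ⊤) (n : ℕ) :
    2 * ∑ k ∈ Finset.range n, ∑ j ∈ F, Sg.reach W d w j k ≤ (Sg.rawRun W d w n).home := by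
  induction n with
  | zero => simp
  | succ n ih =>
    rw [Finset.sum_range_succ, mul_add]
    exact (add_le_add_left ih _).trans (Sg.home_succ_ge hF n)

/-- Targets that are hidden in `d'` are not found as long as the search for `d'` does not reach
them. -/
theorem eq_of_mem_found (h : ∀ i, d' i = ⊤ ∨ d' i = d i) {n : ℕ}
    (hn : ∀ j, d' j = ⊤ → d j ≠ ⊤ → ∀ k < n, Sg.reach W d' w j k < d j) :
    ∀ i ∈ (Sg.rawRun W d w n).found, d' i = d i := by
  induction n with
  | zero => simp [rawRun]
  | succ n ih =>
    have ih := ih fun j h1 h2 k hk => hn j h1 h2 k (by omega)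
    have hrun := Sg.rawRun_congr h ih
    rw [rawRun]
    rcases Sg.rawStep_cases W d w (Sg.rawRun W d w n) with hc | ⟨r, l, hs, -, hr, hl, hc, -⟩
    · rwa [hc.1]
    · rw [hc]
      intro i hi
      rcases Finset.mem_insert.1 hi with rfl | hi
      · refine (h i).resolve_left fun ht => ?_
        rw [hrun] at hs
        have := hn i ht hr n (by omega)
        rw [Sg.reach_eq_of_some hs] at this
        exact absurd hl (not_le.2 this)
      · exact ih i hi

theorem rawStep_found {st : SearchState m} {j : Fin m} {l : ℝ≥0∞} (hs : Sg W st.hist = some (j, l))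
    (hj : j ∉ st.found) (hd : d j ≠ ⊤) (hl : d j ≤ l) :
    (Sg.rawStep W d w st).found = insert j st.found ∧
      (Sg.rawStep W d w st).home = st.home + 2 * d j := by
  unfold rawStep
  rw [hs]
  simp [hj, hd, hl]

/-- Either this find is the last one, or the searcher has also walked back from it before the later
find that completes the search. -/
theorem home_add_dist_le_cost (I : WSInstance m) {k : ℕ} {j : Fin m} {l : ℝ≥0∞}
    (hk : ¬ I.W ≤ I.weight (Sg.rawRun I.W I.d I.w k).found)
    (hs : Sg I.W (Sg.rawRun I.W I.d I.w k).hist = some (j, l))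
    (hj : j ∉ (Sg.rawRun I.W I.d I.w k).found) (hd : I.d j ≠ ⊤) (hl : I.d j ≤ l) :
    (Sg.rawRun I.W I.d I.w k).home + I.d j ≤ Sg.cost I := by
  obtain ⟨h1, h2⟩ := Sg.rawStep_found (w := I.w) hs hj hd hl
  rcases Sg.cost_cases I hk with h | ⟨k', r, hkk, hr, hins, -, h⟩
  · simp [h]
  · rw [h]
    rcases hkk.eq_or_lt with rfl | hlt
    · rw [rawRun, h1] at hins
      have : j ∈ insert r (Sg.rawRun I.W I.d I.w k).found := hins ▸ Finset.mem_insert_self _ _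
      rw [(Finset.mem_insert.1 this).resolve_right hj]
    · have h3 := Sg.home_mono (W := I.W) (d := I.d) (w := I.w) (show k + 1 ≤ k' from hlt)
      simp only at h3
      rw [rawRun, h2, two_mul, ← add_assoc] at h3
      exact (le_self_add.trans h3).trans le_self_add

end Strategy

/-! ### The lower bound for `s < m` -/

/-- Targets at distance `1` on the first `s - 1` rays, and nothing on the others. -/
def nearDist (m s : ℕ) (i : Fin m) : ℝ≥0∞ := if (i : ℕ) < s - 1 then 1 else ⊤

/-- The rays on which the last target may be hidden. -/
def farRays (m s : ℕ) : Finset (Fin m) := {i | ¬ (i : ℕ) < s - 1}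

theorem nearDist_eq_top {m s : ℕ} {i : Fin m} (hi : i ∈ farRays m s) : nearDist m s i = ⊤ := by
  simp only [farRays, Finset.mem_filter] at hi
  simp [nearDist, hi.2]

theorem card_near {m s : ℕ} (hs : s < m) :
    (Finset.univ.filter fun i : Fin m => (i : ℕ) < s - 1).card = s - 1 := by
  have := Fin.card_filter_val_lt (n := m) (m := s - 1)
  rw [this]; omega

theorem card_farRays {m s : ℕ} (hs1 : 1 ≤ s) (hs : s < m) : (farRays m s).card = m - s + 1 := by
  have h1 := card_near hs
  have h2 := Finset.card_filter_add_card_filter_not (s := (Finset.univ : Finset (Fin m)))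
    fun i : Fin m => (i : ℕ) < s - 1
  rw [h1, Finset.card_univ, Fintype.card_fin] at h2
  unfold farRays
  omega

/-- The instance with targets at distance `1` on the first `s - 1` rays and one at distance `x` on
ray `j`, all of which are needed. -/
def hardInstance (m s : ℕ) (j : Fin m) (x : ℝ) (hx : 1 ≤ x) : WSInstance m :=
  WSInstance.tight (fun i => if i = j then ENNReal.ofReal x else nearDist m s i) (by
    intro i
    unfold nearDist
    split_ifs
    · simpa using hx
    · exact le_rfl
    · exact le_top)

section hardInstance

variable {m s : ℕ} {j : Fin m} {x : ℝ} {hx : 1 ≤ x}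

theorem hardInstance_targets : (hardInstance m s j x hx).targets =
    insert j (Finset.univ.filter fun i : Fin m => (i : ℕ) < s - 1) := by
  ext i
  rw [WSInstance.mem_targets]
  simp only [hardInstance, WSInstance.tight, nearDist, Finset.mem_insert, Finset.mem_filter]
  by_cases h1 : i = j
  · simp [h1]
  · by_cases h2 : (i : ℕ) < s - 1 <;> simp [h1, h2]

theorem hardInstance_card (hs1 : 1 ≤ s) (hs : s < m) (hj : j ∈ farRays m s) :
    (hardInstance m s j x hx).targets.card = s := by
  rw [hardInstance_targets, Finset.card_insert_of_notMem, card_near hs]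
  · omega
  · simp only [farRays, Finset.mem_filter] at hj
    simp [hj.2]

theorem hardInstance_tight : (hardInstance m s j x hx).Tight := WSInstance.tight_tight _ _

theorem hardInstance_d (i : Fin m) : (hardInstance m s j x hx).d i =
    if i = j then ENNReal.ofReal x else nearDist m s i := rfl

theorem hardInstance_opt_le (hs1 : 1 ≤ s) (hs : s < m) (hj : j ∈ farRays m s) :
    (hardInstance m s j x hx).opt ≤ ENNReal.ofReal (2 * ((s : ℝ) - 1) + x) := by
  have hj' : j ∉ Finset.univ.filter fun i : Fin m => (i : ℕ) < s - 1 := by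
    simp only [farRays, Finset.mem_filter] at hj
    simp [hj.2]
  have hmem : j ∈ (hardInstance m s j x hx).targets := by
    rw [hardInstance_targets]; exact Finset.mem_insert_self _ _
  rw [hardInstance_tight.opt_eq]
  refine (WSInstance.setCost_le hmem).trans (le_of_eq ?_)
  have hs0 : (0 : ℝ) ≤ (s : ℝ) - 1 := by
    have : (1 : ℝ) ≤ s := by exact_mod_cast hs1
    linarith
  rw [hardInstance_targets, Finset.erase_insert hj', Finset.sum_congr rfl (g := fun _ => 1),
    Finset.sum_const, card_near hs, hardInstance_d, if_pos rfl,
    ENNReal.ofReal_add (by linarith) (by linarith), ENNReal.ofReal_mul (by norm_num)]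
  · congr 2
    · simp
    · rw [show (s : ℝ) - 1 = ((s - 1 : ℕ) : ℝ) by rw [Nat.cast_sub hs1, Nat.cast_one],
        ENNReal.ofReal_natCast]
      simp
  · intro i hi
    have h1 : i ≠ j := fun h => hj' (h ▸ hi)
    simp only [Finset.mem_filter] at hi
    simp [hardInstance_d, h1, nearDist, hi.2]

end hardInstance

/-- Until ray `j` is first explored to depth `x`, the search cannot distinguish the hard instance
from `nearDist`. The hypothetical run on `nearDist` thus serves all `j` and `x` at once. -/
theorem exists_exploration {m s : ℕ} (hs1 : 1 ≤ s) (hs : s < m) (Sg : Strategy m) {j : Fin m}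
    (hj : j ∈ farRays m s) {x : ℝ} (hx : 1 ≤ x) (hfin : Sg.cost (hardInstance m s j x hx) ≠ ⊤) :
    ∃ k, ENNReal.ofReal x ≤ Sg.reach s (nearDist m s) (fun _ => 1) j k ∧
      (Sg.rawRun s (nearDist m s) (fun _ => 1) k).home + ENNReal.ofReal x ≤
        Sg.cost (hardInstance m s j x hx) := by
  classical
  set I := hardInstance m s j x hx with hI
  have hW : I.W = s := by rw [hardInstance_tight.W_eq, hardInstance_card hs1 hs hj]
  have hw : I.w = fun _ => 1 := rfl
  have hjd : I.d j = ENNReal.ofReal x := by rw [hI, hardInstance_d, if_pos rfl]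
  have hd : ∀ i, nearDist m s i = ⊤ ∨ nearDist m s i = I.d i := by
    intro i
    by_cases hij : i = j
    · left; rw [hij]; exact nearDist_eq_top hj
    · right; rw [hI, hardInstance_d, if_neg hij]
  have honly : ∀ i, nearDist m s i = ⊤ → I.d i ≠ ⊤ → i = j := by
    intro i h1 h2
    by_contra hij
    rw [hI, hardInstance_d, if_neg hij] at h2
    exact h2 h1
  have hne : nearDist m s j ≠ I.d j := by
    rw [nearDist_eq_top hj, hjd]; exact ENNReal.top_ne_ofReal
  have hunf : ∀ n, j ∉ (Sg.rawRun I.W I.d I.w n).found →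
      ¬ I.W ≤ I.weight (Sg.rawRun I.W I.d I.w n).found := by
    intro n hn hc
    rw [hardInstance_tight.le_weight_iff fun i hi => I.mem_targets.2 (Sg.found_finite n i hi)] at hc
    rw [hc, hardInstance_targets] at hn
    exact hn (Finset.mem_insert_self _ _)
  have hex : ∃ k, I.d j ≤ Sg.reach I.W (nearDist m s) I.w j k := by
    by_contra hc
    push Not at hc
    have hnot : ∀ n, j ∉ (Sg.rawRun I.W I.d I.w n).found := fun n hn =>
      hne (Sg.eq_of_mem_found hd (fun i h1 h2 k _ => by rw [honly i h1 h2]; exact hc k) j hn)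
    rcases Sg.cost_cases I (hunf 0 (hnot 0)) with h | ⟨k, r, -, -, -, h, -⟩
    · exact hfin h
    · exact hunf _ (hnot _) h
  have hspec := Nat.find_spec hex
  have hmin : ∀ k < Nat.find hex, Sg.reach I.W (nearDist m s) I.w j k < I.d j :=
    fun k hk => not_le.1 (Nat.find_min hex hk)
  generalize Nat.find hex = k at hspec hmin
  have hfound := Sg.eq_of_mem_found (n := k) hd
    (fun i h1 h2 k' hk' => by rw [honly i h1 h2]; exact hmin k' hk')
  have hrun := Sg.rawRun_congr hd hfound
  have hjk : j ∉ (Sg.rawRun I.W I.d I.w k).found := fun h => hne (hfound j h)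
  have hpos : Sg.reach I.W (nearDist m s) I.w j k ≠ 0 := by
    intro h0
    rw [h0, hjd] at hspec
    have := ENNReal.ofReal_eq_zero.1 (le_antisymm hspec zero_le)
    linarith
  have hsome := Sg.eq_some_of_reach hpos
  rw [← hrun] at hsome
  have hle := Sg.home_add_dist_le_cost I (hunf k hjk) hsome hjk (by rw [hjd]; simp) hspec
  rw [hrun, hjd, hW, hw] at hle
  rw [hjd, hW, hw] at hspec
  exact ⟨k, hspec, hle⟩

theorem lower_bound {m : ℕ} (Sg : Strategy m) (s : ℕ) (hs1 : 1 ≤ s) (hs : s < m) (ε : ℝ)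
    (hε : 0 < ε) : ∃ I : WSInstance m, I.optCard = s ∧
      ENNReal.ofReal (phi ((m : ℝ) - (s : ℝ)) - ε) * I.opt ≤ Sg.cost I := by
  classical
  by_contra hcon
  push Not at hcon
  set P : ℝ := phi ((m : ℝ) - (s : ℝ)) - ε with hP
  set F := farRays m s with hF
  have hFc : F.card = m - s + 1 := card_farRays hs1 hs
  have hcost : ∀ j ∈ F, ∀ (x : ℝ) (hx : 1 ≤ x), Sg.cost (hardInstance m s j x hx) <
      ENNReal.ofReal P * ENNReal.ofReal (2 * ((s : ℝ) - 1) + x) := by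
    intro j hj x hx
    refine (hcon _ ?_).trans_le ?_
    · rw [hardInstance_tight.optCard_eq, hardInstance_card hs1 hs hj]
    · gcongr
      exact hardInstance_opt_le hs1 hs hj
  obtain ⟨j₀, hj₀⟩ : F.Nonempty := Finset.card_pos.1 (by omega)
  have hP0 : 0 < P := by
    by_contra h
    have := hcost j₀ hj₀ 1 le_rfl
    rw [ENNReal.ofReal_of_nonpos (not_lt.1 h), zero_mul] at this
    exact not_lt_zero this
  set R := Sg.reach s (nearDist m s) (fun _ => 1) with hR
  set run := Sg.rawRun s (nearDist m s) (fun _ => 1) with hrun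
  have hs0 : (0 : ℝ) ≤ (s : ℝ) - 1 := by
    have : (1 : ℝ) ≤ s := by exact_mod_cast hs1
    linarith
  have hexp : ∀ j ∈ F, ∀ x : ℝ, 1 ≤ x → ∃ k, ENNReal.ofReal x ≤ R j k ∧
      (run k).home + ENNReal.ofReal x ≤ ENNReal.ofReal (P * (2 * ((s : ℝ) - 1) + x)) := by
    intro j hj x hx
    have h1 := hcost j hj x hx
    rw [← ENNReal.ofReal_mul hP0.le] at h1
    obtain ⟨k, h2, h3⟩ := exists_exploration hs1 hs Sg hj hx (h1.trans ENNReal.ofReal_lt_top).ne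
    exact ⟨k, h2, h3.trans h1.le⟩
  have hhome : ∀ n, 2 * ∑ k ∈ Finset.range n, ∑ j ∈ F, R j k ≤ (run n).home := fun n =>
    Sg.two_mul_sum_reach_le (fun j hj => nearDist_eq_top hj) n
  -- After an infinitely deep exploration of `j`, a target on another far ray `j'`, beyond
  -- everything explored there before, would be found only at infinite cost. This needs two far
  -- rays, that is, `s < m`.
  have hfin : ∀ k, ∀ j ∈ F, R j k ≠ ⊤ := by
    by_contra hc
    push Not at hc
    have hspec := Nat.find_spec hc
    have hmin : ∀ k < Nat.find hc, ∀ j ∈ F, R j k ≠ ⊤ := fun k hk j hj h =>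
      Nat.find_min hc hk ⟨j, hj, h⟩
    generalize Nat.find hc = k at hspec hmin
    obtain ⟨j, hj, hjk⟩ := hspec
    obtain ⟨j', hj', hne⟩ : ∃ j' ∈ F, j' ≠ j := by
      have : 0 < (F.erase j).card := by rw [Finset.card_erase_of_mem hj]; omega
      obtain ⟨j', h⟩ := Finset.card_pos.1 this
      exact ⟨j', Finset.mem_of_mem_erase h, Finset.ne_of_mem_erase h⟩
    obtain ⟨k', hk', hk'2⟩ := hexp j' hj' (1 + ∑ i ∈ Finset.range k, (R j' i).toReal)
      (le_add_of_nonneg_right (Finset.sum_nonneg fun _ _ => ENNReal.toReal_nonneg))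
    have hnn : 0 ≤ ∑ i ∈ Finset.range k, (R j' i).toReal :=
      Finset.sum_nonneg fun _ _ => ENNReal.toReal_nonneg
    rcases lt_trichotomy k' k with hlt | rfl | hlt
    · have h1 := hmin k' hlt j' hj'
      have h2 := (ENNReal.ofReal_le_iff_le_toReal h1).1 hk'
      have h3 := Finset.single_le_sum (f := fun i => (R j' i).toReal)
        (fun _ _ => ENNReal.toReal_nonneg) (Finset.mem_range.2 hlt)
      linarith
    · have h1 : R j' k' ≠ 0 := by
        intro h0
        rw [h0] at hk'
        have := ENNReal.ofReal_eq_zero.1 (le_antisymm hk' zero_le)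
        linarith
      have h2 := Sg.eq_some_of_reach h1
      have h3 := Sg.eq_some_of_reach (j := j) (show R j k' ≠ 0 by rw [hjk]; exact ENNReal.top_ne_zero)
      rw [h2, Option.some.injEq, Prod.mk.injEq] at h3
      exact hne h3.1
    · have h1 : (⊤ : ℝ≥0∞) ≤ 2 * ∑ i ∈ Finset.range k', ∑ j ∈ F, R j i := by
        have h2 : (⊤ : ℝ≥0∞) ≤ ∑ j ∈ F, R j k := by
          rw [← hjk]; exact Finset.single_le_sum (f := fun j => R j k) (fun _ _ => zero_le) hj
        have h3 : ∑ j ∈ F, R j k ≤ ∑ i ∈ Finset.range k', ∑ j ∈ F, R j i :=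
          Finset.single_le_sum (f := fun i => ∑ j ∈ F, R j i) (fun _ _ => zero_le)
            (Finset.mem_range.2 hlt)
        rw [top_le_iff.1 (h2.trans h3)]
        simp
      have h4 := (h1.trans (hhome k')).trans (le_self_add.trans hk'2)
      exact absurd (top_le_iff.1 h4) ENNReal.ofReal_ne_top
  set l : ℕ → ℝ := fun k => (∑ j ∈ F, R j k).toReal with hl
  -- The default `j₀` is harmless: idle steps have length `l k = 0`, as do explorations outside `F`.
  set r : ℕ → Fin m := fun k => ((Sg s (run k).hist).map Prod.fst).getD j₀ with hr
  have hlsum : ∀ n, ENNReal.ofReal (2 * ∑ k ∈ Finset.range n, l k) ≤ (run n).home := by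
    intro n
    refine le_trans (le_of_eq ?_) (hhome n)
    rw [ENNReal.ofReal_mul (by norm_num),
      ENNReal.ofReal_sum_of_nonneg fun _ _ => ENNReal.toReal_nonneg, ENNReal.ofReal_ofNat]
    congr 1
    exact Finset.sum_congr rfl fun k _ =>
      ENNReal.ofReal_toReal (ENNReal.sum_ne_top.2 fun j hj => hfin k j hj)
  -- From `2 ∑ l + x ≤ P (2 (s - 1) + x)` with `x = y + 1` one gets `∑ l ≤ (P - 1)/2 * (y + 1) + P
  -- (s - 1)`. The shift to `y + 1` makes `y < l k` strict.
  have hmain := ray_search_lower_bound (F := F) (r := r) (l := l) (L := max 0 ((P - 1) / 2))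
    (C := max 0 ((P - 1) / 2) + P * ((s : ℝ) - 1)) (by omega) (fun _ => ENNReal.toReal_nonneg)
    (le_max_left _ _) ?_
  · rw [hFc] at hmain
    have h1 : ((m - s + 1 : ℕ) : ℝ) - 1 = (m : ℝ) - s := by
      push_cast [Nat.cast_sub hs.le]; ring
    have h2 : phi ((m : ℝ) - s) = 1 + 2 * (((m - s + 1 : ℕ) : ℝ) *
        (1 + 1 / (((m - s + 1 : ℕ) : ℝ) - 1)) ^ (m - s + 1 - 1)) := by
      rw [phi, h1, Nat.add_sub_cancel, ← Nat.cast_sub hs.le, Real.rpow_natCast]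
      push_cast; ring
    have h3 : 0 < ((m - s + 1 : ℕ) : ℝ) *
        (1 + 1 / (((m - s + 1 : ℕ) : ℝ) - 1)) ^ (m - s + 1 - 1) := by
      rw [h1, ← Nat.cast_sub hs.le]; positivity
    rcases max_cases 0 ((P - 1) / 2) with h | h <;> linarith
  · intro j hj y hy
    obtain ⟨k, h1, h2⟩ := hexp j hj (y + 1) (by linarith)
    have h0 : R j k ≠ 0 := by
      intro h0
      rw [h0] at h1
      have := ENNReal.ofReal_eq_zero.1 (le_antisymm h1 zero_le)
      linarith
    refine ⟨k, ?_, ?_, ?_⟩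
    · simp only [hr, hrun, Sg.eq_some_of_reach h0]; rfl
    · simp only [hl]
      rw [Sg.sum_reach hj h0]
      have := (ENNReal.ofReal_le_iff_le_toReal (hfin k j hj)).1 h1
      linarith
    · have hnn : 0 ≤ ∑ i ∈ Finset.range k, l i := Finset.sum_nonneg fun _ _ => ENNReal.toReal_nonneg
      have h3 := (add_le_add_left (hlsum k) _).trans h2
      rw [← ENNReal.ofReal_add (by linarith) (by linarith),
        ENNReal.ofReal_le_ofReal_iff (mul_nonneg hP0.le (by linarith))] at h3
      have h4 : (P - 1) / 2 * (y + 1) ≤ max 0 ((P - 1) / 2) * (y + 1) :=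
        mul_le_mul_of_nonneg_right (le_max_right _ _) (by linarith)
      linarith

/-! ### The lower bound for `s = m` -/

theorem lower_bound_all {m : ℕ} (hm : 2 ≤ m) (Sg : Strategy m) (ε : ℝ) (hε : 0 < ε) :
    ∃ I : WSInstance m, I.optCard = m ∧ ENNReal.ofReal (2 - ε) * I.opt ≤ Sg.cost I := by
  classical
  set R := Sg.reach m (fun _ => ⊤) (fun _ => 1) with hR
  set run := Sg.rawRun m (fun _ => ⊤) (fun _ => 1) with hrun
  have hfacts : ∀ (d : Fin m → ℝ≥0∞) (hd : ∀ i, 1 ≤ d i), (∀ i, d i ≠ ⊤) →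
      (WSInstance.tight d hd).targets = Finset.univ ∧ (WSInstance.tight d hd).W = m := by
    intro d hd hfin
    have h1 : (WSInstance.tight d hd).targets = Finset.univ := by
      ext i; simpa [WSInstance.mem_targets, WSInstance.tight] using hfin i
    refine ⟨h1, ?_⟩
    rw [(WSInstance.tight_tight d hd).W_eq, h1]; simp
  have hcard : ∀ (d : Fin m → ℝ≥0∞) (hd : ∀ i, 1 ≤ d i), (∀ i, d i ≠ ⊤) →
      (WSInstance.tight d hd).optCard = m := by
    intro d hd hfin
    rw [(WSInstance.tight_tight d hd).optCard_eq, (hfacts d hd hfin).1]; simp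
  have hagree : ∀ (d : Fin m → ℝ≥0∞) (hd : ∀ i, 1 ≤ d i), (∀ i, d i ≠ ⊤) → ∀ n,
      (∀ j, ∀ k < n, R j k < d j) →
      Sg.rawRun m d (fun _ => 1) n = run n ∧ (Sg.rawRun m d (fun _ => 1) n).found = ∅ := by
    intro d hd hfin n hn
    have h1 := Sg.eq_of_mem_found (W := m) (d := d) (d' := fun _ => ⊤) (w := fun _ => 1) (n := n)
      (fun _ => Or.inl rfl) (fun j _ _ k hk => hn j k hk)
    refine ⟨Sg.rawRun_congr (fun _ => Or.inl rfl) h1, ?_⟩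
    rw [Finset.eq_empty_iff_forall_notMem]
    exact fun i hi => hfin i (h1 i hi).symm
  have hunf : ∀ (d : Fin m → ℝ≥0∞) (hd : ∀ i, 1 ≤ d i), (∀ i, d i ≠ ⊤) → ∀ A : Finset (Fin m),
      A.card < m → ¬ (m : ℝ≥0) ≤ (WSInstance.tight d hd).weight A := by
    intro d hd hfin A hA
    rw [(WSInstance.tight_tight d hd).weight_eq, Nat.cast_le]
    omega
  have hm1 : (1 : ℝ≥0∞) ≤ 2 * m := by
    exact_mod_cast (by omega : 1 ≤ 2 * m)
  have htwo : ENNReal.ofReal (2 - ε) ≤ 2 := by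
    rw [← ENNReal.ofReal_ofNat]
    exact ENNReal.ofReal_le_ofReal (by linarith)
  -- The depth to which ray `j` has been explored in the first `n` explorations, if nothing is ever
  -- found.
  set y : ℕ → Fin m → ℝ≥0∞ := fun n j => (Finset.range n).sup (R j) with hy
  by_cases ha : ∃ n, (∀ j, y n j ≠ ⊤) ∧ ∃ j, 2 * (m : ℝ≥0∞) ≤ y n j
  · obtain ⟨n, hfin, j, hj⟩ := ha
    have hd : ∀ i, 1 ≤ y n i + 1 := fun i => le_add_self
    have hdf : ∀ i, y n i + 1 ≠ ⊤ := fun i => ENNReal.add_ne_top.2 ⟨hfin i, ENNReal.one_ne_top⟩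
    set I := WSInstance.tight (fun i => y n i + 1) hd with hI
    obtain ⟨hT, hW⟩ := hfacts _ hd hdf
    refine ⟨I, hcard _ hd hdf, ?_⟩
    obtain ⟨h1, h2⟩ := hagree (fun i => y n i + 1) hd hdf n fun i k hk =>
      (Finset.le_sup (f := R i) (Finset.mem_range.2 hk)).trans_lt
        (ENNReal.lt_add_right (hfin i) one_ne_zero)
    have h3 := Sg.home_add_opt_le_cost I (n := n)
      (by
        rw [hW]
        refine hunf _ hd hdf _ ?_
        change (Sg.rawRun m (fun i => y n i + 1) (fun _ => 1) n).found.card < m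
        rw [h2]; simp; omega)
      (by rw [hW]; exact h2)
    rw [hW, show I.d = fun i => y n i + 1 from rfl, show I.w = fun _ => 1 from rfl, h1] at h3
    -- Placing the targets at `y + 1` adds `2m` to twice the sum, but the subtracted maximum is at
    -- least `2m`. This is the origin of the threshold.
    have h4 : I.opt ≤ 2 * ∑ i, y n i := by
      rw [(WSInstance.tight_tight _ hd).opt_eq, hT, WSInstance.setCost, tsub_le_iff_right]
      change 2 * ∑ i, (y n i + 1) ≤ 2 * ∑ i, y n i + Finset.univ.sup fun i => y n i + 1
      rw [Finset.sum_add_distrib, mul_add]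
      gcongr
      have h5 : y n j + 1 ≤ Finset.univ.sup fun i => y n i + 1 :=
        Finset.le_sup (f := fun i => y n i + 1) (Finset.mem_univ j)
      refine le_trans ?_ h5
      simpa using hj.trans le_self_add
    have h6 : 2 * ∑ i, y n i ≤ (run n).home := by
      refine le_trans ?_ (Sg.two_mul_sum_reach_le (F := Finset.univ) (fun _ _ => rfl) n)
      rw [Finset.sum_comm]
      gcongr with i
      exact Finset.sup_le fun k hk => Finset.single_le_sum (f := R i) (fun _ _ => zero_le) hk
    calc ENNReal.ofReal (2 - ε) * I.opt ≤ 2 * I.opt := by gcongr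
      _ = I.opt + I.opt := two_mul _
      _ ≤ (run n).home + I.opt := by gcongr; exact h4.trans h6
      _ ≤ _ := h3
  push Not at ha
  by_cases hb : ∃ k, ∃ j, R j k = ⊤
  · have hspec := Nat.find_spec hb
    have hmin : ∀ k < Nat.find hb, ∀ j, R j k ≠ ⊤ := fun k hk j h => Nat.find_min hb hk ⟨j, h⟩
    generalize Nat.find hb = k at hspec hmin
    obtain ⟨j, hj⟩ := hspec
    have hylt := ha k fun i => ((Finset.sup_lt_iff ENNReal.zero_lt_top).2 fun k' hk' =>
      (hmin k' (Finset.mem_range.1 hk') i).lt_top).ne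
    -- All depths before exploration `k` are below `2m`, so nothing is found until the target at
    -- `X`. Another target remains since `m ≥ 2`, so `2X` is walked. As `ε X ≥ 8 m²`, this is at
    -- least `(2 - ε) (4 m² + X)`.
    set X : ℝ := 8 * (m : ℝ) ^ 2 / ε + 2 * m with hX
    have hX2 : 2 * (m : ℝ≥0∞) ≤ ENNReal.ofReal X := by
      rw [← ENNReal.ofReal_natCast, ← ENNReal.ofReal_ofNat, ← ENNReal.ofReal_mul (by norm_num)]
      exact ENNReal.ofReal_le_ofReal (le_add_of_nonneg_left (by positivity))
    set d : Fin m → ℝ≥0∞ := fun i => if i = j then ENNReal.ofReal X else 2 * m with hdd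
    have hd2 : ∀ i, 2 * (m : ℝ≥0∞) ≤ d i := by
      intro i; simp only [hdd]; split_ifs
      · exact hX2
      · exact le_rfl
    have hd : ∀ i, 1 ≤ d i := fun i => hm1.trans (hd2 i)
    have hdf : ∀ i, d i ≠ ⊤ := by
      intro i; simp only [hdd]; split_ifs
      · exact ENNReal.ofReal_ne_top
      · exact ENNReal.mul_ne_top (by simp) (by simp)
    have hdj : d j = ENNReal.ofReal X := by simp [hdd]
    set I := WSInstance.tight d hd with hI
    obtain ⟨hT, hW⟩ := hfacts _ hd hdf
    refine ⟨I, hcard _ hd hdf, ?_⟩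
    obtain ⟨h1, h2⟩ := hagree d hd hdf k fun i k' hk' =>
      ((Finset.le_sup (f := R i) (Finset.mem_range.2 hk')).trans_lt (hylt i)).trans_le (hd2 i)
    have hsome := Sg.eq_some_of_reach (j := j) (show R j k ≠ 0 by rw [hj]; exact ENNReal.top_ne_zero)
    rw [show Sg.rawRun m (fun _ => ⊤) (fun _ => 1) k = run k from rfl, ← h1] at hsome
    obtain ⟨h3, h4⟩ := Sg.rawStep_found (w := fun _ => 1) hsome (by rw [h2]; simp) (hdf j)
      (by rw [show Sg.reach m (fun _ => ⊤) (fun _ => 1) j k = ⊤ from hj]; exact le_top)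
    have h5 := Sg.home_le_cost I (n := k + 1) (by
      rw [hW]
      refine hunf _ hd hdf _ ?_
      change (Sg.rawStep m d (fun _ => 1) (Sg.rawRun m d (fun _ => 1) k)).found.card < m
      rw [h3, h2]; simp; omega)
    have h6 : 2 * d j ≤ Sg.cost I := by
      refine le_trans ?_ h5
      rw [hW]
      change _ ≤ (Sg.rawStep m d (fun _ => 1) (Sg.rawRun m d (fun _ => 1) k)).home
      rw [h4]; exact le_add_self
    have h7 : I.opt ≤ ENNReal.ofReal (4 * (m : ℝ) ^ 2 + X) := by
      rw [(WSInstance.tight_tight d hd).opt_eq, hT]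
      refine (WSInstance.setCost_le (Finset.mem_univ j)).trans ?_
      change 2 * ∑ i ∈ Finset.univ.erase j, d i + d j ≤ _
      have hX0 : 0 ≤ X := by rw [hX]; positivity
      rw [hdj, ENNReal.ofReal_add (by positivity) hX0]
      refine add_le_add ?_ le_rfl
      rw [Finset.sum_congr rfl (g := fun _ => 2 * (m : ℝ≥0∞)) fun i hi => by
        simp [hdd, Finset.ne_of_mem_erase hi], Finset.sum_const,
        Finset.card_erase_of_mem (Finset.mem_univ j), Finset.card_univ, Fintype.card_fin]
      have e : ENNReal.ofReal (4 * (m : ℝ) ^ 2) = 2 * (m • (2 * (m : ℝ≥0∞))) := by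
        rw [show 4 * (m : ℝ) ^ 2 = ((4 * m ^ 2 : ℕ) : ℝ) by push_cast; ring,
          ENNReal.ofReal_natCast]
        push_cast
        rw [nsmul_eq_mul]; ring
      rw [e]
      gcongr
      omega
    refine le_trans ?_ h6
    rw [hdj]
    by_cases hε2 : 2 - ε ≤ 0
    · rw [ENNReal.ofReal_of_nonpos hε2, zero_mul]; exact zero_le
    · refine (mul_le_mul_right h7 _).trans ?_
      rw [← ENNReal.ofReal_mul (by linarith), ← ENNReal.ofReal_ofNat,
        ← ENNReal.ofReal_mul (by norm_num)]
      refine ENNReal.ofReal_le_ofReal ?_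
      have hεX : 8 * (m : ℝ) ^ 2 ≤ ε * X := by
        rw [hX, mul_add, mul_div_cancel₀ _ hε.ne']
        exact le_add_of_nonneg_right (by positivity)
      nlinarith [(by positivity : 0 ≤ ε * (m : ℝ) ^ 2)]
  -- No exploration is infinite and no depth reaches `2m`, so targets at distance `2m` are never
  -- found and the cost is infinite.
  · push Not at hb
    have hd : ∀ _ : Fin m, (1 : ℝ≥0∞) ≤ 2 * m := fun _ => hm1
    have hdf : ∀ _ : Fin m, (2 * m : ℝ≥0∞) ≠ ⊤ := fun _ => ENNReal.mul_ne_top (by simp) (by simp)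
    obtain ⟨hT, hW⟩ := hfacts _ hd hdf
    set I := WSInstance.tight (fun _ => 2 * (m : ℝ≥0∞)) hd with hI
    refine ⟨I, hcard _ hd hdf, ?_⟩
    have hempty : ∀ n, (Sg.rawRun I.W I.d I.w n).found = ∅ := by
      intro n
      rw [hW]
      refine (hagree (fun _ => 2 * (m : ℝ≥0∞)) hd hdf n fun i k hk => ?_).2
      refine (Finset.le_sup (f := R i) (Finset.mem_range.2 hk)).trans_lt (ha n (fun i => ?_) i)
      exact ((Finset.sup_lt_iff ENNReal.zero_lt_top).2 fun k' _ => (hb k' i).lt_top).ne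
    have hun : ∀ n, ¬ I.W ≤ I.weight (Sg.rawRun I.W I.d I.w n).found := by
      intro n
      rw [hempty n, hW]
      exact hunf _ hd hdf _ (by simp; omega)
    rcases Sg.cost_cases I (hun 0) with h | ⟨k, r, -, -, -, h, -⟩
    · simp [h]
    · exact absurd h (hun _)

end

theorem theorem3 (m : ℕ) :
    -- upper bounds
    (∀ I : WSInstance m,
      (I.optCard < m →
        (adSch m).cost I ≤ ENNReal.ofReal (phi ((m : ℝ) - (I.optCard : ℝ))) * I.opt) ∧
      (¬ I.optCard < m →
        (adSch m).cost I ≤ ENNReal.ofReal (3 + 2 * Real.exp 1) * I.opt)) ∧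
    -- lower bound for each value `1 ≤ s ≤ m - 1` of the parameter
    (∀ (Sg : Strategy m) (s : ℕ), 1 ≤ s → s < m → ∀ ε : ℝ, 0 < ε →
      ∃ I : WSInstance m, I.optCard = s ∧
        ENNReal.ofReal (phi ((m : ℝ) - (s : ℝ)) - ε) * I.opt ≤ Sg.cost I) ∧
    -- lower bound for the extreme value of the parameter
    (2 ≤ m → ∀ (Sg : Strategy m) (ε : ℝ), 0 < ε →
      ∃ I : WSInstance m, I.optCard = m ∧
        ENNReal.ofReal (2 - ε) * I.opt ≤ Sg.cost I) := by
  exact ⟨fun I => cost_adSch_le_opt I, fun Sg s h1 h2 ε hε => lower_bound Sg s h1 h2 ε hε,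
    fun hm Sg ε hε => lower_bound_all hm Sg ε hε⟩
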